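/- Let $p>2$. A \emph{single-knot metric graph} $\mathcal G$ consists of $H\ge 1$ half-lines, $P\ge 0$ pendants and $L\ge 0$ loops, all attached at a single vertex $\mathbf 0$; each pendant or loop $\kappa$ has a length $\ell_\kappa\in(0,\infty)$ and is identified with $[0,\ell_\kappa]$, each half-line is identified with $[0,\infty)$, the vertex being the point $0$ of each edge (and also the point $\ell_\kappa$ of a loop). Let $H^1(\mathcal G)$ be the space of continuous functions $u:\mathcal G\to\mathbb R$ whose restriction to each edge belongs to $H^1$ of that edge. A \emph{bound-state} is a function $u\in H^1(\mathcal G)$, $u\not\equiv 0$, that is a weak solution of $-u''+u=|u|^{p-2}u$ on $\mathcal G$, i.e. $$\int_{\mathcal G}u'\eta'+u\eta-|u|^{p-2}u\,\eta\,dx=0\qquad\text{for all }\eta\in H^1(\mathcal G).$$ The action is $$S(u)=\frac12\int_{\mathcal G}|u'|^2+|u|^2\,dx-\frac1p\int_{\mathcal G}|u|^p\,dx,$$ the least action level $\mathcal S_{\mathcal G}$ is the infimum of $S$ over all bound-states, and an \emph{action ground-state} is a bound-state $u$ with $S(u)=\mathcal S_{\mathcal G}$. Suppose that $\mathcal G$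 has (1) an even number of half-lines, or (2) at least two pendants with the same length, or (3) at least two loops with the same length. Then there exists a bound-state on $\mathcal G$. If, in addition, $$\sum_{\kappa\text{ pendant}}\tanh \ell_\kappa+2\sum_{\kappa\text{ loop}}\tanh\frac{\ell_\kappa}{2}\neq H-2n\qquad\text{for all } n=0,1,\dots,\lfloor H/2\rfloor,$$ then there exists an action ground-state on $\mathcal G$. -/

import Mathlib

open MeasureTheory Set
open scoped ContDiff

noncomputable section

/-- On the open set `s ⊆ ℝ`, the locally integrable function `g` is a weak (distributional)
derivative of the locally integrable function `f`. -/
def HasWeakDerivOn (s : Set ℝ) (f g : ℝ → ℝ) : Prop :=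
  LocallyIntegrableOn f s ∧ LocallyIntegrableOn g s ∧
    ∀ φ : ℝ → ℝ, ContDiff ℝ ∞ φ → HasCompactSupport φ → tsupport φ ⊆ s →
      ∫ x in s, f x * deriv φ x = -∫ x in s, g x * φ x

/-- The Sobolev space `H¹(s) = W^{1,2}(s)` of an open set `s ⊆ ℝ`. -/
def MemH1On (s : Set ℝ) (f : ℝ → ℝ) : Prop :=
  MemLp f 2 (volume.restrict s) ∧
    ∃ g : ℝ → ℝ, HasWeakDerivOn s f g ∧ MemLp g 2 (volume.restrict s)

open Classical in
/-- A representative of the weak derivative of `f` on `s` (two weak derivatives agree almost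
everywhere on `s`); the value is `0` if there is no weak derivative. -/
def weakDerivOn (s : Set ℝ) (f : ℝ → ℝ) : ℝ → ℝ :=
  if h : ∃ g : ℝ → ℝ, HasWeakDerivOn s f g then h.choose else 0

/-- A single-knot metric graph: `H ≥ 1` half-lines, `P ≥ 0` pendants and `L ≥ 0` loops (of
prescribed positive lengths), all attached at one vertex. -/
structure SingleKnotGraph where
  /-- number of half-lines -/
  H : ℕ
  /-- number of pendants -/
  P : ℕ
  /-- number of loops -/
  L : ℕ
  one_le_H : 1 ≤ H
  /-- lengths of the pendants -/
  pendantLength : Fin P → ℝ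
  /-- lengths of the loops -/
  loopLength : Fin L → ℝ
  pendantLength_pos : ∀ i, 0 < pendantLength i
  loopLength_pos : ∀ j, 0 < loopLength j

namespace SingleKnotGraph

/-- The edges: half-lines, pendants, loops (in this order). -/
abbrev Edge (G : SingleKnotGraph) : Type := Fin G.H ⊕ (Fin G.P ⊕ Fin G.L)

/-- The half-line with index `i`. -/
abbrev halfLine (G : SingleKnotGraph) (i : Fin G.H) : G.Edge := Sum.inl i

/-- The pendant with index `i`. -/
abbrev pendant (G : SingleKnotGraph) (i : Fin G.P) : G.Edge := Sum.inr (Sum.inl i)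

/-- The loop with index `j`. -/
abbrev loop (G : SingleKnotGraph) (j : Fin G.L) : G.Edge := Sum.inr (Sum.inr j)

/-- The interval identified with an edge: `[0, ∞)` for a half-line, `[0, ℓ]` for a compact edge
of length `ℓ`. The point `0` of every edge is the vertex, and so is the point `ℓ` of a loop. -/
def closedEdge (G : SingleKnotGraph) : G.Edge → Set ℝ
  | Sum.inl _ => Ici 0
  | Sum.inr (Sum.inl i) => Icc 0 (G.pendantLength i)
  | Sum.inr (Sum.inr j) => Icc 0 (G.loopLength j)

/-- The interior of the interval identified with an edge. -/
def openEdge (G : SingleKnotGraph) : G.Edge → Set ℝ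
  | Sum.inl _ => Ioi 0
  | Sum.inr (Sum.inl i) => Ioo 0 (G.pendantLength i)
  | Sum.inr (Sum.inr j) => Ioo 0 (G.loopLength j)

/-- `u ∈ H¹(G)`: a real function on the graph is given by its restrictions `u e` to the edges
(only the values on `G.closedEdge e` matter); it is continuous on the graph, i.e. continuous on
every closed edge with a single value at the vertex, and `H¹` on every edge. -/
structure MemH1 (G : SingleKnotGraph) (u : G.Edge → ℝ → ℝ) : Prop where
  continuousOn : ∀ e, ContinuousOn (u e) (G.closedEdge e)
  vertex : ∀ e e', u e 0 = u e' 0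
  loop_end : ∀ j, u (G.loop j) (G.loopLength j) = u (G.loop j) 0
  memH1On : ∀ e, MemH1On (G.openEdge e) (u e)

/-- The integral over the graph. -/
def integral (G : SingleKnotGraph) (f : G.Edge → ℝ → ℝ) : ℝ :=
  ∑ e, ∫ x in G.openEdge e, f e x

/-- The (edgewise) weak derivative. -/
def weakDeriv (G : SingleKnotGraph) (u : G.Edge → ℝ → ℝ) : G.Edge → ℝ → ℝ :=
  fun e => weakDerivOn (G.openEdge e) (u e)

/-- The action `S(u) = ½ ∫ (|u'|² + |u|²) - (1/p) ∫ |u|ᵖ`. -/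
def action (G : SingleKnotGraph) (p : ℝ) (u : G.Edge → ℝ → ℝ) : ℝ :=
  1 / 2 * G.integral (fun e x => G.weakDeriv u e x ^ 2 + u e x ^ 2)
    - 1 / p * G.integral (fun e x => |u e x| ^ p)

/-- A bound-state: a nontrivial weak solution `u ∈ H¹(G)` of `-u'' + u = |u|^{p-2} u`, tested
against all of `H¹(G)`. -/
structure IsBoundState (G : SingleKnotGraph) (p : ℝ) (u : G.Edge → ℝ → ℝ) : Prop where
  memH1 : G.MemH1 u
  nontrivial : ∃ e, ∃ x ∈ G.closedEdge e, u e x ≠ 0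
  weak : ∀ η : G.Edge → ℝ → ℝ, G.MemH1 η →
    G.integral (fun e x => G.weakDeriv u e x * G.weakDeriv η e x + u e x * η e x
      - |u e x| ^ (p - 2) * u e x * η e x) = 0

/-- The least action level, the infimum of the action over all bound-states (taken in the extended
reals, so it is `⊤` if there are none). -/
def leastActionLevel (G : SingleKnotGraph) (p : ℝ) : EReal :=
  sInf {s : EReal | ∃ u, G.IsBoundState p u ∧ s = (G.action p u : EReal)}

/-- An action ground-state: a bound-state attaining the least action level. -/
def IsActionGroundState (G : SingleKnotGraph) (p : ℝ) (u : G.Edge → ℝ → ℝ) : Prop :=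
  G.IsBoundState p u ∧ (G.action p u : EReal) = G.leastActionLevel p

/-- The condition
`∑_{pendants} tanh ℓ + 2 ∑_{loops} tanh (ℓ / 2) ≠ H - 2 n` for `n = 0, …, ⌊H / 2⌋`. -/
def TanhCondition (G : SingleKnotGraph) : Prop :=
  ∀ n : ℕ, n ≤ G.H / 2 →
    ∑ i, Real.tanh (G.pendantLength i) + 2 * ∑ j, Real.tanh (G.loopLength j / 2)
      ≠ (G.H : ℝ) - 2 * (n : ℝ)

end SingleKnotGraph

end

open Filter Topology NNReal

namespace NLS

/-! ### The nonlinearity, the energy and elementary properties of solutions -/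

/-! A bound-state is the same thing as a family of classical `H¹` solutions of `u'' = u - |u|^(p-2)
u` on the edges, continuous at the vertex, with zero derivative at the tips of the pendants and
outgoing derivatives at the vertex summing to zero (`IsClassical.isBoundState`,
`IsBoundState.exists_isClassical`). The energy `v²/2 - u²/2 + |u|^p/p` is constant on each edge. On
a half-line integrability forces it to be zero, so the Cauchy data there lie on the orbit of the
soliton or of its negative.

Existence is by construction. If `H` is even, take the constant solution `1` on all compact edges
and pieces of soliton through the value `1` on the half-lines, half of them rising and half falling,
so that their slopes cancel. With two equal pendants or loops, put `w` on one and `-w` on the other,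
where `w` vanishes at the vertex and solves a mixed or Dirichlet problem; `w` comes from shooting in
the initial slope (`exists_isSol_mixed`, `exists_isSol_dirichlet`).

For ground states, the Nehari identity turns the action of a bound-state into a positive multiple of
`∫ |u|^p`. Along a minimizing sequence of bound-states this quantity bounds the energies on the
compact edges, hence the Cauchy data at the vertex. These live in a finite-dimensional compact set,
so a subsequence converges, continuous dependence carries the solutions and the vertex conditions to
the limit, and `∫ |u|^p` is lower semicontinuous (`exists_isBoundState_lpPow_le`).

The only possible failure is a zero limit (`not_tendsto_zero`). Then the vertex value `a` and all
slopes tend to zero. In this regime zero energy makes each half-line slope close to `±a`, while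
comparison with the linear equation makes the flux into a pendant close to `-a tanh ℓ` and into a
loop close to `-2a tanh (ℓ/2)`. Dividing the Kirchhoff condition by `a` and letting `a → 0` gives
exactly an equality excluded by `TanhCondition`. -/

/-- The nonlinearity `u - |u|^(p-2) u` in the equation `u'' = u - |u|^(p-2) u`. -/
noncomputable def force (p u : ℝ) : ℝ := u - |u| ^ (p - 2) * u

/-- `(u, v)` solves `u' = v`, `v' = u - |u|^(p-2) u` on `s`. -/
def IsSol (p : ℝ) (s : Set ℝ) (u v : ℝ → ℝ) : Prop :=
  ∀ x ∈ s, HasDerivWithinAt u (v x) s x ∧ HasDerivWithinAt v (force p (u x)) s x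

/-- The energy `v²/2 - u²/2 + |u|^p/p`, conserved along solutions. -/
noncomputable def energy (p u v : ℝ) : ℝ := v ^ 2 / 2 - u ^ 2 / 2 + |u| ^ p / p

variable {p : ℝ}

/-- The origin needs a separate argument: the slope there is `|u|^(p-2)`, which tends to zero
because `p > 2`. Elsewhere this is the product rule. -/
theorem hasDerivAt_abs_rpow_mul_self (hp : 2 < p) (x : ℝ) :
    HasDerivAt (fun u : ℝ => |u| ^ (p - 2) * u) ((p - 1) * |x| ^ (p - 2)) x := by
  rcases eq_or_ne x 0 with rfl | hx
  · rw [hasDerivAt_iff_tendsto_slope]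
    have h0 : (p - 1) * |(0:ℝ)| ^ (p - 2) = 0 := by
      rw [abs_zero, Real.zero_rpow (by linarith), mul_zero]
    rw [h0]
    have hc : Continuous fun u : ℝ => |u| ^ (p - 2) :=
      continuous_abs.rpow_const fun _ => Or.inr (by linarith)
    have h1 : Tendsto (fun u : ℝ => |u| ^ (p - 2)) (𝓝[≠] 0) (𝓝 0) := by
      have := hc.tendsto 0
      rw [abs_zero, Real.zero_rpow (by linarith)] at this
      exact this.mono_left nhdsWithin_le_nhds
    refine h1.congr' ?_
    filter_upwards [self_mem_nhdsWithin] with y hy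
    have hy : y ≠ 0 := hy
    simp [slope_def_field, hy]
  · have h1 := ((hasDerivAt_abs hx).rpow_const (p := p - 2) (Or.inl (abs_ne_zero.2 hx))).mul
      (hasDerivAt_id x)
    refine h1.congr_deriv ?_
    have h2 : |x| ^ (p - 2) = |x| ^ (p - 2 - 1) * |x| := by
      rw [← Real.rpow_add_one (abs_ne_zero.2 hx)]; ring_nf
    have h3 : (SignType.sign x : ℝ) * x = |x| := by
      rcases lt_or_gt_of_ne hx with h | h
      · simp [sign_neg h, abs_of_neg h]
      · simp [sign_pos h, abs_of_pos h]
    simp only [id, mul_one]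
    calc _ = (p - 2) * (|x| ^ (p - 2 - 1) * ((SignType.sign x : ℝ) * x)) + |x| ^ (p - 2) := by ring
      _ = _ := by rw [h3, ← h2]; ring

theorem hasDerivAt_force (hp : 2 < p) (x : ℝ) :
    HasDerivAt (force p) (1 - (p - 1) * |x| ^ (p - 2)) x :=
  (hasDerivAt_id x).sub (hasDerivAt_abs_rpow_mul_self hp x)

theorem continuous_force (hp : 2 < p) : Continuous (force p) :=
  continuous_iff_continuousAt.2 fun x => (hasDerivAt_force hp x).continuousAt

@[simp] theorem force_zero : force p 0 = 0 := by simp [force]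

theorem force_neg (u : ℝ) : force p (-u) = -force p u := by
  simp only [force, abs_neg]; ring

theorem force_one : force p 1 = 0 := by simp [force]

theorem abs_rpow_eq_mul_sq (hp : 2 < p) (u : ℝ) : |u| ^ p = |u| ^ (p - 2) * u ^ 2 := by
  rcases eq_or_ne u 0 with rfl | hu
  · simp [Real.zero_rpow (show p ≠ 0 by linarith)]
  · rw [← sq_abs, ← Real.rpow_natCast, ← Real.rpow_add (abs_pos.2 hu)]; norm_num

theorem energy_eq (hp : 2 < p) (u v : ℝ) :
    energy p u v = v ^ 2 / 2 - u ^ 2 / 2 + |u| ^ (p - 2) * u ^ 2 / p := by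
  rw [energy, abs_rpow_eq_mul_sq hp]

theorem energy_zero_left (hp : 2 < p) (v : ℝ) : energy p 0 v = v ^ 2 / 2 := by
  rw [energy_eq hp]; simp

theorem exists_lipschitz_force (hp : 2 < p) (R : ℝ) :
    ∃ K : ℝ≥0, LipschitzOnWith K (force p) (Icc (-R) R) := by
  have hpos : 0 ≤ p - 1 := by linarith
  have hK : 0 ≤ 1 + (p - 1) * |R| ^ (p - 2) := by positivity
  refine ⟨Real.toNNReal (1 + (p - 1) * |R| ^ (p - 2)), ?_⟩
  refine Convex.lipschitzOnWith_of_nnnorm_hasDerivWithin_le (convex_Icc _ _)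
    (fun x _ => (hasDerivAt_force hp x).hasDerivWithinAt) fun x hx => ?_
  rw [← NNReal.coe_le_coe]
  rw [Real.coe_toNNReal _ hK, coe_nnnorm, Real.norm_eq_abs]
  have h1 : |x| ≤ |R| := (abs_le.2 hx).trans (le_abs_self R)
  have h2 : |x| ^ (p - 2) ≤ |R| ^ (p - 2) :=
    Real.rpow_le_rpow (abs_nonneg _) h1 (by linarith)
  have h3 : 0 ≤ |x| ^ (p - 2) := by positivity
  have h4 := mul_le_mul_of_nonneg_left h2 hpos
  have h5 := mul_nonneg hpos h3
  rw [abs_le]; constructor <;> linarith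

theorem IsSol.mono {s t : Set ℝ} {u v : ℝ → ℝ} (h : IsSol p s u v) (hts : t ⊆ s) :
    IsSol p t u v :=
  fun x hx => ⟨(h x (hts hx)).1.mono hts, (h x (hts hx)).2.mono hts⟩

theorem IsSol.continuousOn {s : Set ℝ} {u v : ℝ → ℝ} (h : IsSol p s u v) : ContinuousOn u s :=
  fun x hx => (h x hx).1.continuousWithinAt

theorem IsSol.continuousOn_deriv {s : Set ℝ} {u v : ℝ → ℝ} (h : IsSol p s u v) :
    ContinuousOn v s :=
  fun x hx => (h x hx).2.continuousWithinAt

theorem isSol_zero (s : Set ℝ) : IsSol p s (fun _ => 0) (fun _ => 0) := fun x _ =>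
  ⟨hasDerivWithinAt_const _ _ _, by simpa using hasDerivWithinAt_const x s (0:ℝ)⟩

theorem isSol_one (s : Set ℝ) : IsSol p s (fun _ => 1) (fun _ => 0) := fun x _ =>
  ⟨hasDerivWithinAt_const _ _ _, by simpa [force_one] using hasDerivWithinAt_const x s (0:ℝ)⟩

theorem IsSol.neg {s : Set ℝ} {u v : ℝ → ℝ} (h : IsSol p s u v) :
    IsSol p s (fun x => -u x) (fun x => -v x) := fun x hx =>
  ⟨(h x hx).1.neg, (h x hx).2.neg.congr_deriv (force_neg _).symm⟩

/-- Reflection of a solution. -/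
theorem IsSol.comp_const_sub {s t : Set ℝ} {u v : ℝ → ℝ} (h : IsSol p s u v) (c : ℝ)
    (ht : MapsTo (fun x => c - x) t s) :
    IsSol p t (fun x => u (c - x)) (fun x => -v (c - x)) := fun x hx => by
  have h0 : HasDerivWithinAt (fun x => c - x) (-1) t x := by
    simpa using (hasDerivWithinAt_id x t).const_sub c
  constructor
  · exact ((h _ (ht hx)).1.scomp x h0 ht).congr_deriv (by simp)
  · exact ((h _ (ht hx)).2.scomp x h0 ht).neg.congr_deriv (by simp)

/-- Translation of a solution. -/
theorem IsSol.comp_const_add {s t : Set ℝ} {u v : ℝ → ℝ} (h : IsSol p s u v) (c : ℝ)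
    (ht : MapsTo (fun x => c + x) t s) :
    IsSol p t (fun x => u (c + x)) (fun x => v (c + x)) := fun x hx => by
  have h0 : HasDerivWithinAt (fun x => c + x) 1 t x := by
    simpa using (hasDerivWithinAt_id x t).const_add c
  constructor
  · exact ((h _ (ht hx)).1.scomp x h0 ht).congr_deriv (by simp)
  · exact ((h _ (ht hx)).2.scomp x h0 ht).congr_deriv (by simp)

theorem hasDerivWithinAt_energy (hp : 2 < p) {s : Set ℝ} {u v : ℝ → ℝ} (h : IsSol p s u v) {x : ℝ}
    (hx : x ∈ s) : HasDerivWithinAt (fun y => energy p (u y) (v y)) 0 s x := by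
  obtain ⟨hu, hv⟩ := h x hx
  have h1 := ((hv.pow 2).div_const 2).sub ((hu.pow 2).div_const 2)
  have h2 := ((hasDerivAt_abs_rpow (u x) (show 1 < p by linarith)).comp_hasDerivWithinAt x
    hu).div_const p
  refine (h1.add h2).congr_deriv ?_
  have hp0 : p ≠ 0 := by linarith
  simp only [force]
  field_simp
  push_cast
  ring

theorem IsSol.energy_eq_energy (hp : 2 < p) {s : Set ℝ} (hs : Convex ℝ s) {u v : ℝ → ℝ}
    (h : IsSol p s u v) {x y : ℝ} (hx : x ∈ s) (hy : y ∈ s) :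
    energy p (u x) (v x) = energy p (u y) (v y) := by
  have := hs.norm_image_sub_le_of_norm_hasDerivWithin_le (C := 0)
    (f := fun y => energy p (u y) (v y)) (f' := fun _ => 0)
    (fun z hz => hasDerivWithinAt_energy hp h hz) (by simp) hy hx
  rw [zero_mul, norm_le_zero_iff, sub_eq_zero] at this
  exact this

/-- Sublevel sets of the energy are bounded. -/
theorem exists_bound_of_energy_le (hp : 2 < p) (E : ℝ) :
    ∃ R : ℝ, 0 ≤ R ∧ ∀ u v : ℝ, energy p u v ≤ E → |u| ≤ R ∧ |v| ≤ R := by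
  -- Beyond `K` one has `|u|^p/p ≥ u²`, so the energy dominates `(u² + v²)/2`; below `K` the
  -- negative term is at most `K²/2`.
  set K : ℝ := p ^ (1 / (p - 2)) with hK
  have hK0 : 0 ≤ K := by positivity
  have hp2 : 0 < p - 2 := by linarith
  have hp0 : 0 < p := by linarith
  refine ⟨Real.sqrt (2 * |E| + K ^ 2), Real.sqrt_nonneg _, fun u v h => ?_⟩
  rw [energy_eq hp] at h
  have hE := le_abs_self E
  have hE0 := abs_nonneg E
  have key : u ^ 2 ≤ 2 * |E| + K ^ 2 ∧ v ^ 2 ≤ 2 * |E| + K ^ 2 := by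
    rcases le_total |u| K with hu | hu
    · have h1 : u ^ 2 ≤ K ^ 2 := by rw [← sq_abs u]; gcongr
      have h2 : 0 ≤ |u| ^ (p - 2) * u ^ 2 / p := by positivity
      constructor <;> linarith
    · have h1 : p ≤ |u| ^ (p - 2) := by
        calc p = K ^ (p - 2) := by
              rw [hK, ← Real.rpow_mul hp0.le, one_div, inv_mul_cancel₀ hp2.ne', Real.rpow_one]
          _ ≤ _ := Real.rpow_le_rpow hK0 hu hp2.le
      have h2 : u ^ 2 ≤ |u| ^ (p - 2) * u ^ 2 / p := by
        rw [le_div_iff₀ hp0]; nlinarith [sq_nonneg u]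
      have h3 := sq_nonneg u
      have h4 := sq_nonneg v
      have h5 := sq_nonneg K
      constructor <;> linarith
  exact ⟨Real.abs_le_sqrt key.1, Real.abs_le_sqrt key.2⟩

/-! ### The initial value problem -/

/-- Truncation to the interval `[-R, R]`. -/
noncomputable def clamp (R x : ℝ) : ℝ := max (-R) (min x R)

theorem clamp_mem {R : ℝ} (hR : 0 ≤ R) (x : ℝ) : clamp R x ∈ Icc (-R) R :=
  ⟨le_max_left _ _, max_le (by linarith) (min_le_right _ _)⟩

theorem clamp_of_abs_le {R x : ℝ} (hx : |x| ≤ R) : clamp R x = x := by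
  rw [abs_le] at hx
  rw [clamp, min_eq_left hx.2, max_eq_right hx.1]

theorem lipschitzWith_clamp (R : ℝ) : LipschitzWith 1 (clamp R) :=
  (LipschitzWith.id.min_const R).const_max (-R)

/-- The truncated equation has solutions on every bounded interval. -/
theorem exists_truncated_sol (hp : 2 < p) {R : ℝ} (hR : 0 ≤ R) {T : ℝ} (hT : 0 ≤ T) (a b : ℝ) :
    ∃ u v : ℝ → ℝ, u 0 = a ∧ v 0 = b ∧ ∀ x ∈ Icc 0 T,
      HasDerivWithinAt u (clamp R (v x)) (Icc 0 T) x ∧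
        HasDerivWithinAt v (force p (clamp R (u x))) (Icc 0 T) x := by
  obtain ⟨K, hK⟩ := exists_lipschitz_force hp R
  set F : ℝ × ℝ → ℝ × ℝ := fun z => (clamp R z.2, force p (clamp R z.1)) with hF
  have hFl : LipschitzWith (max (1 * 1) (K * (1 * 1))) F := by
    refine ((lipschitzWith_clamp R).comp LipschitzWith.prod_snd).prodMk ?_
    have h1 : LipschitzOnWith (1 * 1) (fun z : ℝ × ℝ => clamp R z.1) univ :=
      ((lipschitzWith_clamp R).comp LipschitzWith.prod_fst).lipschitzOnWith
    exact lipschitzOnWith_univ.1 (hK.comp h1 fun z _ => clamp_mem hR _)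
  set L : ℝ≥0 := Real.toNNReal (R + K * R) with hL
  have hLe : (L : ℝ) = R + K * R := Real.coe_toNNReal _ (by positivity)
  have hbound : ∀ z, ‖F z‖ ≤ L := fun z => by
    rw [hLe, hF, Prod.norm_mk]
    have h1 : ‖clamp R z.2‖ ≤ R := abs_le.2 (clamp_mem hR _)
    have h2 : ‖clamp R z.1‖ ≤ R := abs_le.2 (clamp_mem hR _)
    have h3 := hK.dist_le_mul _ (clamp_mem hR z.1) 0 ⟨by linarith, hR⟩
    rw [force_zero, dist_zero_right, dist_zero_right] at h3
    have h4 : (K : ℝ) * ‖clamp R z.1‖ ≤ K * R := by gcongr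
    have h5 : 0 ≤ (K : ℝ) * R := by positivity
    exact max_le (by linarith) (by linarith)
  -- The truncated field is globally Lipschitz and bounded by `L`, so a ball of radius `L * T`
  -- suffices and the whole interval is covered at once.
  have hPL : IsPicardLindelof (fun _ => F) (tmin := 0) (tmax := T) ⟨0, le_refl 0, hT⟩ (a, b)
      (L * Real.toNNReal T) 0 L (max (1 * 1) (K * (1 * 1))) :=
    { lipschitzOnWith := fun t _ => hFl.lipschitzOnWith
      continuousOn := fun x _ => continuousOn_const
      norm_le := fun t _ x _ => hbound x
      mul_max_le := by
        simp [hT, Real.coe_toNNReal T hT] }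
  obtain ⟨z, hz0, hz⟩ := hPL.exists_eq_forall_mem_Icc_hasDerivWithinAt₀
  refine ⟨fun x => (z x).1, fun x => (z x).2, congrArg Prod.fst hz0, congrArg Prod.snd hz0,
    fun x hx => ?_⟩
  have h := hasDerivWithinAt_iff_hasFDerivWithinAt.1 (hz x hx)
  constructor
  · exact h.fst.hasDerivWithinAt.congr_deriv (by simp [hF])
  · exact h.snd.hasDerivWithinAt.congr_deriv (by simp [hF])

/-- Solutions of the initial value problem exist for all times. -/
theorem exists_isSol (hp : 2 < p) {T : ℝ} (hT : 0 ≤ T) (a b : ℝ) :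
    ∃ u v : ℝ → ℝ, u 0 = a ∧ v 0 = b ∧ IsSol p (Icc 0 T) u v := by
  obtain ⟨R, hR, hbd⟩ := exists_bound_of_energy_le hp (energy p a b)
  -- The truncation level exceeds the a priori bound `R` by one. As long as the solution stays below
  -- `R + 1` it solves the true equation, conserves energy and is therefore below `R`; so it can
  -- never reach `R + 1`.
  obtain ⟨u, v, hu0, hv0, huv⟩ := exists_truncated_sol hp (by linarith : 0 ≤ R + 1) hT a b
  refine ⟨u, v, hu0, hv0, ?_⟩
  have hcu : ContinuousOn u (Icc 0 T) := fun x hx => (huv x hx).1.continuousWithinAt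
  have hcv : ContinuousOn v (Icc 0 T) := fun x hx => (huv x hx).2.continuousWithinAt
  set M : ℝ → ℝ := fun x => max |u x| |v x| with hM
  have hcM : ContinuousOn M (Icc 0 T) := hcu.abs.sup hcv.abs
  have sol_of : ∀ s ∈ Icc 0 T, (∀ x ∈ Icc 0 s, M x ≤ R + 1) → IsSol p (Icc 0 s) u v := by
    intro s hs h x hx
    have hsub : Icc 0 s ⊆ Icc 0 T := Icc_subset_Icc_right hs.2
    obtain ⟨h1, h2⟩ := huv x (hsub hx)
    rw [clamp_of_abs_le ((le_max_right _ _).trans (h x hx))] at h1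
    rw [clamp_of_abs_le ((le_max_left _ _).trans (h x hx))] at h2
    exact ⟨h1.mono hsub, h2.mono hsub⟩
  have hMR : ∀ s ∈ Icc 0 T, (∀ x ∈ Icc 0 s, M x ≤ R + 1) → M s ≤ R := by
    intro s hs h
    have h1 := (sol_of s hs h).energy_eq_energy hp (convex_Icc _ _) (right_mem_Icc.2 hs.1)
      (left_mem_Icc.2 hs.1)
    rw [hu0, hv0] at h1
    exact max_le (hbd _ _ h1.le).1 (hbd _ _ h1.le).2
  have hall : ∀ x ∈ Icc 0 T, M x ≤ R + 1 := by
    by_contra! hcon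
    obtain ⟨y, hy, hyM⟩ := hcon
    have hK : IsCompact (Icc 0 T ∩ M ⁻¹' Ici (R + 1)) :=
      isCompact_Icc.of_isClosed_subset
        (hcM.preimage_isClosed_of_isClosed isClosed_Icc isClosed_Ici) inter_subset_left
    -- `s` is the first time at which the level `R + 1` is reached.
    obtain ⟨s, ⟨hs, hsM⟩, hmin⟩ := hK.exists_isLeast ⟨y, hy, hyM.le⟩
    have hlt : ∀ x ∈ Ico 0 s, M x < R + 1 := fun x hx => by
      by_contra! h
      exact absurd (hmin ⟨⟨hx.1, hx.2.le.trans hs.2⟩, h⟩) (not_le.2 hx.2)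
    have hs0 : 0 < s := by
      rcases hs.1.eq_or_lt with h | h
      · exfalso
        subst h
        have h2 := hbd a b le_rfl
        have h3 : M 0 ≤ R := by
          rw [hM]; simp only [hu0, hv0]; exact max_le h2.1 h2.2
        have : R + 1 ≤ M 0 := hsM
        linarith
      · exact h
    have hle : M s ≤ R + 1 := by
      have hcs : ContinuousWithinAt M (Ico 0 s) s :=
        (hcM s hs).mono fun x hx => ⟨hx.1, hx.2.le.trans hs.2⟩
      have : s ∈ closure (Ico 0 s) := by
        rw [closure_Ico hs0.ne]; exact right_mem_Icc.2 hs0.le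
      exact (isClosed_Iic (a := R + 1)).closure_subset_iff.2
        (image_subset_iff.2 fun x hx => (hlt x hx).le) (hcs.mem_closure_image this)
    have h1 := hMR s hs fun x hx => by
      rcases hx.2.eq_or_lt with h | h
      · rw [h]; exact hle
      · exact (hlt x ⟨hx.1, h⟩).le
    have : R + 1 ≤ M s := hsM
    linarith
  exact sol_of T ⟨hT, le_rfl⟩ hall

theorem IsSol.abs_le_of_energy_le (hp : 2 < p) {E R : ℝ}
    (hR : ∀ u v : ℝ, energy p u v ≤ E → |u| ≤ R ∧ |v| ≤ R) {s : Set ℝ} (hs : Convex ℝ s)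
    {u v : ℝ → ℝ} (h : IsSol p s u v) {x₀ : ℝ} (hx₀ : x₀ ∈ s)
    (hE : energy p (u x₀) (v x₀) ≤ E) {x : ℝ} (hx : x ∈ s) : |u x| ≤ R ∧ |v x| ≤ R :=
  hR _ _ ((h.energy_eq_energy hp hs hx hx₀).trans_le hE)

/-- Lipschitz dependence on the initial data, uniformly for bounded energies. -/
theorem exists_dist_le (hp : 2 < p) (E : ℝ) {T : ℝ} (hT : 0 ≤ T) :
    ∃ C : ℝ, 0 ≤ C ∧ ∀ u₁ v₁ u₂ v₂ : ℝ → ℝ, IsSol p (Icc 0 T) u₁ v₁ → IsSol p (Icc 0 T) u₂ v₂ →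
      energy p (u₁ 0) (v₁ 0) ≤ E → energy p (u₂ 0) (v₂ 0) ≤ E →
      ∀ x ∈ Icc 0 T, max |u₁ x - u₂ x| |v₁ x - v₂ x| ≤
        C * max |u₁ 0 - u₂ 0| |v₁ 0 - v₂ 0| := by
  obtain ⟨R, hR0, hR⟩ := exists_bound_of_energy_le hp E
  obtain ⟨K, hK⟩ := exists_lipschitz_force hp R
  set K' : ℝ≥0 := max 1 (K * 1)
  refine ⟨Real.exp (K' * T), (Real.exp_pos _).le, fun u₁ v₁ u₂ v₂ h₁ h₂ hE₁ hE₂ x hx => ?_⟩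
  set F : ℝ × ℝ → ℝ × ℝ := fun z => (z.2, force p z.1) with hF
  have hFl : LipschitzOnWith K' F {z | z.1 ∈ Icc (-R) R} := by
    refine LipschitzOnWith.prodMk LipschitzWith.prod_snd.lipschitzOnWith ?_
    exact hK.comp LipschitzWith.prod_fst.lipschitzOnWith fun z hz => hz
  have hder : ∀ {u v : ℝ → ℝ}, IsSol p (Icc 0 T) u v → ∀ t ∈ Ico 0 T,
      HasDerivWithinAt (fun t => (u t, v t)) (F (u t, v t)) (Ici t) t := fun h t ht => by
    have hm : Icc 0 T ∈ 𝓝[Ici t] t :=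
      mem_of_superset (Icc_mem_nhdsGE ht.2) (Icc_subset_Icc_left ht.1)
    have := h t ⟨ht.1, ht.2.le⟩
    exact (this.1.mono_of_mem_nhdsWithin hm).prodMk (this.2.mono_of_mem_nhdsWithin hm)
  have h0 : (0:ℝ) ∈ Icc 0 T := ⟨le_rfl, hT⟩
  -- Grönwall: the energy bound confines both trajectories to the strip `|u| ≤ R`, where the field
  -- is `K'`-Lipschitz.
  have key := dist_le_of_trajectories_ODE_of_mem (v := fun _ => F)
    (s := fun _ => {z | z.1 ∈ Icc (-R) R}) (K := K') (a := 0) (b := T) (fun _ _ => hFl)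
    (h₁.continuousOn.prodMk h₁.continuousOn_deriv) (hder h₁)
    (fun t ht => abs_le.1
      (h₁.abs_le_of_energy_le hp hR (convex_Icc _ _) h0 hE₁ ⟨ht.1, ht.2.le⟩).1)
    (h₂.continuousOn.prodMk h₂.continuousOn_deriv) (hder h₂)
    (fun t ht => abs_le.1
      (h₂.abs_le_of_energy_le hp hR (convex_Icc _ _) h0 hE₂ ⟨ht.1, ht.2.le⟩).1) le_rfl x hx
  simp only [Prod.dist_eq, Real.dist_eq] at key
  refine key.trans ?_
  rw [mul_comm]
  gcongr
  linarith [hx.2]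

theorem IsSol.eq_of_eq (hp : 2 < p) {T : ℝ} {u₁ v₁ u₂ v₂ : ℝ → ℝ}
    (h₁ : IsSol p (Icc 0 T) u₁ v₁) (h₂ : IsSol p (Icc 0 T) u₂ v₂) (hu : u₁ 0 = u₂ 0)
    (hv : v₁ 0 = v₂ 0) {x : ℝ} (hx : x ∈ Icc 0 T) : u₁ x = u₂ x ∧ v₁ x = v₂ x := by
  obtain ⟨C, -, hC⟩ := exists_dist_le hp (energy p (u₁ 0) (v₁ 0)) (hx.1.trans hx.2)
  have h := hC u₁ v₁ u₂ v₂ h₁ h₂ le_rfl (by rw [hu, hv]) x hx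
  rw [hu, hv, sub_self, sub_self, abs_zero, max_self, mul_zero] at h
  exact ⟨sub_eq_zero.1 (abs_nonpos_iff.1 ((le_max_left _ _).trans h)),
    sub_eq_zero.1 (abs_nonpos_iff.1 ((le_max_right _ _).trans h))⟩

theorem continuous_energy (hp : 2 < p) : Continuous fun z : ℝ × ℝ => energy p z.1 z.2 := by
  unfold energy
  have : Continuous fun z : ℝ × ℝ => |z.1| ^ p :=
    (continuous_abs.comp continuous_fst).rpow_const fun _ => Or.inr (by linarith)
  fun_prop

/-- Solutions converge if their initial data do. -/
theorem tendsto_of_tendsto_init (hp : 2 < p) {T : ℝ} {u v : ℝ → ℝ}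
    (h : IsSol p (Icc 0 T) u v) {ι : Type*} {l : Filter ι} {U V : ι → ℝ → ℝ}
    (hUV : ∀ n, IsSol p (Icc 0 T) (U n) (V n)) (hU : Tendsto (fun n => U n 0) l (𝓝 (u 0)))
    (hV : Tendsto (fun n => V n 0) l (𝓝 (v 0))) {x : ℝ} (hx : x ∈ Icc 0 T) :
    Tendsto (fun n => U n x) l (𝓝 (u x)) ∧ Tendsto (fun n => V n x) l (𝓝 (v x)) := by
  obtain ⟨C, hC0, hC⟩ := exists_dist_le hp (energy p (u 0) (v 0) + 1) (hx.1.trans hx.2)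
  have hE : ∀ᶠ n in l, energy p (U n 0) (V n 0) ≤ energy p (u 0) (v 0) + 1 := by
    have := ((continuous_energy hp).tendsto (u 0, v 0)).comp (hU.prodMk_nhds hV)
    exact (this.eventually (gt_mem_nhds (lt_add_one _))).mono fun n hn => le_of_lt hn
  have hlim : Tendsto (fun n => C * max |U n 0 - u 0| |V n 0 - v 0|) l (𝓝 0) := by
    have h1 := (hU.sub_const (u 0)).abs
    have h2 := (hV.sub_const (v 0)).abs
    simpa using (h1.max h2).const_mul C
  have hle : ∀ᶠ n in l, max |U n x - u x| |V n x - v x| ≤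
      C * max |U n 0 - u 0| |V n 0 - v 0| := hE.mono fun n hn =>
    hC _ _ _ _ (hUV n) h hn (by linarith) x hx
  constructor
  · rw [tendsto_iff_dist_tendsto_zero]
    exact squeeze_zero' (Eventually.of_forall fun _ => dist_nonneg)
      (hle.mono fun n hn => (le_max_left _ _).trans hn) hlim
  · rw [tendsto_iff_dist_tendsto_zero]
    exact squeeze_zero' (Eventually.of_forall fun _ => dist_nonneg)
      (hle.mono fun n hn => (le_max_right _ _).trans hn) hlim

/-! ### Boundary value problems by shooting -/

theorem mul_sub_le_sub_of_le_deriv {f f' : ℝ → ℝ} {s : Set ℝ} {m x y : ℝ} (hxy : x ≤ y)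
    (hs : Icc x y ⊆ s) (hf : ∀ z ∈ s, HasDerivWithinAt f (f' z) s z)
    (hm : ∀ z ∈ Icc x y, m ≤ f' z) : m * (y - x) ≤ f y - f x := by
  have hd : ∀ z ∈ Ioo x y, HasDerivAt f (f' z) z := fun z hz =>
    ((hf z (hs (Ioo_subset_Icc_self hz))).mono hs).hasDerivAt (Icc_mem_nhds hz.1 hz.2)
  refine (convex_Icc x y).mul_sub_le_image_sub_of_le_deriv
    (fun z hz => ((hf z (hs hz)).mono hs).continuousWithinAt) ?_ ?_ x
    (left_mem_Icc.2 hxy) y (right_mem_Icc.2 hxy) hxy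
  · rw [interior_Icc]
    exact fun z hz => (hd z hz).differentiableAt.differentiableWithinAt
  · rw [interior_Icc]
    exact fun z hz => (hd z hz).deriv.symm ▸ hm z (Ioo_subset_Icc_self hz)

theorem sub_le_mul_sub_of_deriv_le {f f' : ℝ → ℝ} {s : Set ℝ} {m x y : ℝ} (hxy : x ≤ y)
    (hs : Icc x y ⊆ s) (hf : ∀ z ∈ s, HasDerivWithinAt f (f' z) s z)
    (hm : ∀ z ∈ Icc x y, f' z ≤ m) : f y - f x ≤ m * (y - x) := by
  have := mul_sub_le_sub_of_le_deriv (f := fun z => -f z) (f' := fun z => -f' z) (m := -m) hxy hs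
    (fun z hz => (hf z hz).neg) (fun z hz => neg_le_neg (hm z hz))
  linarith

theorem rpow_sub_two_le_one (hp : 2 < p) {u : ℝ} (hu : |u| ≤ 1) : |u| ^ (p - 2) ≤ 1 :=
  Real.rpow_le_one (abs_nonneg _) hu (by linarith)

theorem sq_deriv_of_energy (hp : 2 < p) {u v b : ℝ} (h : energy p u v = energy p 0 b) :
    v ^ 2 = b ^ 2 + u ^ 2 - 2 * (|u| ^ (p - 2) * u ^ 2 / p) := by
  rw [energy_zero_left hp, energy_eq hp] at h
  linarith

/-- Solutions starting at `0` with a small slope stay increasing for a long time. -/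
theorem exists_small_slope (hp : 2 < p) {T : ℝ} (hT : 0 ≤ T) :
    ∃ b₁ : ℝ, 0 < b₁ ∧ ∀ b, 0 < b → b ≤ b₁ → ∀ u v : ℝ → ℝ, IsSol p (Icc 0 T) u v → u 0 = 0 →
      v 0 = b → ∀ x ∈ Icc 0 T, 0 < v x := by
  obtain ⟨C, hC0, hC⟩ := exists_dist_le hp (1 / 2) hT
  -- Comparison with the zero solution gives `|u| ≤ C b ≤ 1`. In that range `2|u|^p/p ≤ u²`, so
  -- conservation of energy gives `v² ≥ b²` and `v` cannot change sign.
  refine ⟨1 / (C + 1), by positivity, fun b hb hb1 u v h hu0 hv0 => ?_⟩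
  have hbC : C * b ≤ 1 := by
    rw [le_div_iff₀ (by positivity)] at hb1; nlinarith
  have hb1' : b ≤ 1 := hb1.trans (by rw [div_le_one (by positivity)]; linarith)
  have hu1 : ∀ x ∈ Icc 0 T, |u x| ≤ 1 := fun x hx => by
    have := hC u v _ _ h (isSol_zero _) (by rw [hu0, hv0, energy_zero_left hp]; nlinarith)
      (by rw [energy_zero_left hp]; norm_num) x hx
    rw [hu0, hv0, sub_zero, sub_zero, sub_zero, sub_zero, abs_zero, abs_of_pos hb,
      max_eq_right hb.le] at this
    exact (le_max_left _ _).trans (this.trans hbC)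
  have hne : ∀ x ∈ Icc 0 T, v x ≠ 0 := fun x hx hvx => by
    have h1 := sq_deriv_of_energy hp (b := b) (by
      rw [h.energy_eq_energy hp (convex_Icc _ _) hx (left_mem_Icc.2 hT), hu0, hv0])
    have h2 := rpow_sub_two_le_one hp (hu1 x hx)
    have h3 : |u x| ^ (p - 2) * u x ^ 2 / p ≤ u x ^ 2 / 2 := by
      gcongr
      exact mul_le_of_le_one_left (sq_nonneg _) h2
    rw [hvx] at h1
    nlinarith [pow_pos hb 2]
  intro x hx
  by_contra! hle
  have hsub : Icc 0 x ⊆ Icc 0 T := Icc_subset_Icc_right hx.2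
  obtain ⟨y, hy, hy0⟩ := intermediate_value_Icc' hx.1 (h.continuousOn_deriv.mono hsub)
    (show (0:ℝ) ∈ Icc (v x) (v 0) from ⟨hle, hv0 ▸ hb.le⟩)
  exact hne y (hsub hy) hy0

/-- Solutions starting at `0` with a large slope do not stay increasing for a long time. -/
theorem exists_large_slope (hp : 2 < p) {T : ℝ} (hT : 0 < T) (b₁ : ℝ) :
    ∃ b : ℝ, b₁ ≤ b ∧ ∀ u v : ℝ → ℝ, IsSol p (Icc 0 T) u v → u 0 = 0 →
      v 0 = b → ∃ x ∈ Icc 0 T, v x < 0 := by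
  have hp0 : 0 < p := by linarith
  have hp2 : 0 < p - 2 := by linarith
  -- `κ` is normalized by `κ (T/4)² = 1`. `K` is the height above which `force p u ≤ -κ u`, and `D`
  -- bounds the term `2|u|^p/p` in the energy identity while `0 ≤ u ≤ K`.
  set κ : ℝ := 16 / T ^ 2 with hκ
  have hκ0 : 0 < κ := by positivity
  set K : ℝ := (1 + κ) ^ (1 / (p - 2)) with hK
  have hK0 : 0 < K := by positivity
  have hKp : K ^ (p - 2) = 1 + κ := by
    rw [hK, ← Real.rpow_mul (by positivity), one_div, inv_mul_cancel₀ hp2.ne', Real.rpow_one]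
  set D : ℝ := 2 * ((1 + κ) * K ^ 2 / p) with hD
  have hD0 : 0 ≤ D := by positivity
  -- With this initial slope `v ≥ 2K/T` as long as `0 ≤ u ≤ K`, so an increasing solution reaches
  -- `K` by time `T/2`. The term `|b₁|` only ensures `b₁ ≤ b`.
  refine ⟨2 * K / T + Real.sqrt D + |b₁|, ?_, fun u v h hu0 hv0 => ?_⟩
  · have := le_abs_self b₁
    have : 0 ≤ 2 * K / T + Real.sqrt D := by positivity
    linarith
  by_contra! hv
  have hmono : ∀ x y, 0 ≤ x → x ≤ y → y ≤ T → u x ≤ u y := fun x y h0 hxy hy => by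
    have hs : Icc x y ⊆ Icc 0 T := Icc_subset_Icc h0 hy
    have := mul_sub_le_sub_of_le_deriv hxy hs (fun z hz => (h z hz).1) fun z hz => hv z (hs hz)
    linarith
  have hhalf : K ≤ u (T / 2) := by
    by_contra! hlt
    have hvb : ∀ x ∈ Icc 0 (T / 2), 2 * K / T ≤ v x := fun x hx => by
      have hxT : x ∈ Icc 0 T := ⟨hx.1, by linarith [hx.2]⟩
      have h1 := sq_deriv_of_energy hp (b := v 0) (by
        rw [h.energy_eq_energy hp (convex_Icc _ _) hxT (left_mem_Icc.2 hT.le), hu0])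
      have h2 : 0 ≤ u x := hu0 ▸ hmono 0 x le_rfl hx.1 hxT.2
      have h3 : u x ≤ K := (hmono x (T / 2) hx.1 hx.2 (by linarith)).trans hlt.le
      have h4 : |u x| ^ (p - 2) * u x ^ 2 / p ≤ (1 + κ) * K ^ 2 / p := by
        rw [← hKp, abs_of_nonneg h2]
        gcongr
      have h5 : (2 * K / T) ^ 2 + D ≤ v 0 ^ 2 := by
        have e1 : 0 ≤ 2 * K / T := by positivity
        have e2 := Real.sqrt_nonneg D
        have e3 := abs_nonneg b₁
        have e4 := Real.sq_sqrt hD0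
        rw [hv0]
        nlinarith [mul_nonneg e1 e2, mul_nonneg (add_nonneg e1 e2) e3]
      exact abs_le_of_sq_le_sq' (by nlinarith [sq_nonneg (u x)]) (hv x hxT) |>.2
    have := mul_sub_le_sub_of_le_deriv (s := Icc 0 T) (by linarith : (0:ℝ) ≤ T / 2)
      (Icc_subset_Icc_right (by linarith)) (fun z hz => (h z hz).1) hvb
    rw [hu0] at this
    have e : 2 * K / T * (T / 2 - 0) = K := by field_simp; ring
    linarith
  have hforce : ∀ x ∈ Icc (T / 2) T, force p (u x) ≤ -κ * u x := fun x hx => by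
    have h1 : K ≤ u x := hhalf.trans (hmono _ _ (by linarith) hx.1 hx.2)
    have h2 : 1 + κ ≤ |u x| ^ (p - 2) := by
      rw [← hKp, abs_of_nonneg (hK0.le.trans h1)]
      exact Real.rpow_le_rpow hK0.le h1 hp2.le
    unfold force
    nlinarith
  have hanti : ∀ x ∈ Icc (T / 2) (3 * T / 4), v (3 * T / 4) ≤ v x := fun x hx => by
    have := sub_le_mul_sub_of_deriv_le (m := 0) (s := Icc 0 T) hx.2
      (Icc_subset_Icc (by linarith [hx.1]) (by linarith)) (fun z hz => (h z hz).2)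
      fun z hz => by
        have hz' : z ∈ Icc (T / 2) T := ⟨hx.1.trans hz.1, by linarith [hz.2]⟩
        have := hforce z hz'
        have : K ≤ u z := hhalf.trans (hmono _ _ (by linarith) hz'.1 hz'.2)
        nlinarith
    linarith
  -- On the third quarter `u` gains at least `v(3T/4) T/4`. On the last quarter `v` then drops by at
  -- least `κ (T/4) u(3T/4) ≥ κ (T/4) K + v(3T/4)`, which makes `v(T)` negative.
  have h1 := mul_sub_le_sub_of_le_deriv (s := Icc 0 T) (by linarith : T / 2 ≤ 3 * T / 4)
    (Icc_subset_Icc (by linarith) (by linarith)) (fun z hz => (h z hz).1) hanti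
  have h2 := sub_le_mul_sub_of_deriv_le (m := -κ * u (3 * T / 4)) (s := Icc 0 T)
    (by linarith : 3 * T / 4 ≤ T)
    (Icc_subset_Icc (by linarith) (by linarith)) (fun z hz => (h z hz).2)
    fun z hz => (hforce z ⟨by linarith [hz.1], hz.2⟩).trans (by
      have := hmono _ _ (by linarith) hz.1 hz.2
      nlinarith)
  have h3 := hv T (right_mem_Icc.2 hT.le)
  have h4 := hv (3 * T / 4) ⟨by linarith, by linarith⟩
  have h5 : u (3 * T / 4) ≥ K + v (3 * T / 4) * (T / 4) := by linarith
  have h6 : κ * (T / 4) * (T / 4) = 1 := by rw [hκ]; field_simp; norm_num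
  have h7 : κ * (T / 4) * (K + v (3 * T / 4) * (T / 4)) ≤ κ * (T / 4) * u (3 * T / 4) := by
    gcongr
  have h8 : 0 < κ * (T / 4) * K := by positivity
  nlinarith

/-- The mixed boundary value problem `u(0) = 0`, `u'(T) = 0` has a nontrivial solution. -/
theorem exists_isSol_mixed (hp : 2 < p) {T : ℝ} (hT : 0 < T) :
    ∃ u v : ℝ → ℝ, IsSol p (Icc 0 T) u v ∧ u 0 = 0 ∧ v T = 0 ∧ v 0 ≠ 0 := by
  choose U V hU hV hUV using fun b : ℝ => exists_isSol hp hT.le 0 b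
  have hloc : ∀ b : ℝ, ∃ C, 0 < C ∧ ∀ b', |b' - b| ≤ 1 → ∀ x ∈ Icc 0 T,
      |V b' x - V b x| ≤ C * |b' - b| := fun b => by
    obtain ⟨C, hC0, hC⟩ := exists_dist_le hp ((|b| + 1) ^ 2 / 2) hT.le
    refine ⟨C + 1, by positivity, fun b' hb' x hx => ?_⟩
    have hb'' : |b'| ≤ |b| + 1 := by
      have := abs_sub_abs_le_abs_sub b' b
      linarith
    have h := hC _ _ _ _ (hUV b') (hUV b)
      (by rw [hU, hV, energy_zero_left hp, ← sq_abs]; gcongr)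
      (by rw [hU, hV, energy_zero_left hp, ← sq_abs]; gcongr; linarith) x hx
    rw [hU, hU, hV, hV, sub_self, abs_zero, max_eq_right (abs_nonneg (b' - b))] at h
    have := abs_nonneg (b' - b)
    linarith [(le_max_right _ _).trans h]
  -- Slopes in `A` keep the solution increasing up to time `T`; slopes in `B` make it decrease
  -- somewhere. Both sets are open, they are disjoint and both meet `[b₁, b₂]`, so by connectedness
  -- some slope lies in neither.
  set A : Set ℝ := {b | ∀ x ∈ Icc 0 T, 0 < V b x} with hA
  set B : Set ℝ := {b | ∃ x ∈ Icc 0 T, V b x < 0} with hB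
  have hAo : IsOpen A := by
    rw [Metric.isOpen_iff]
    intro b hb
    obtain ⟨C, hC0, hC⟩ := hloc b
    obtain ⟨x₀, hx₀, hmin⟩ := isCompact_Icc.exists_isMinOn (nonempty_Icc.2 hT.le)
      (hUV b).continuousOn_deriv
    have hδ := hb x₀ hx₀
    refine ⟨min 1 (V b x₀ / C), by positivity, fun b' hb' x hx => ?_⟩
    rw [Metric.mem_ball, Real.dist_eq, lt_min_iff, lt_div_iff₀ hC0] at hb'
    have h1 := abs_le.1 (hC b' hb'.1.le x hx)
    have h2 : V b x₀ ≤ V b x := hmin hx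
    linarith [hb'.2, h1.1]
  have hBo : IsOpen B := by
    rw [Metric.isOpen_iff]
    rintro b ⟨x, hx, hb⟩
    obtain ⟨C, hC0, hC⟩ := hloc b
    have hb0 : 0 < -V b x := by linarith
    refine ⟨min 1 (-V b x / C), by positivity, fun b' hb' => ⟨x, hx, ?_⟩⟩
    rw [Metric.mem_ball, Real.dist_eq, lt_min_iff, lt_div_iff₀ hC0] at hb'
    have h1 := abs_le.1 (hC b' hb'.1.le x hx)
    linarith [hb'.2, h1.2]
  obtain ⟨b₁, hb₁, hsmall⟩ := exists_small_slope hp hT.le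
  obtain ⟨b₂, hb₂, hlarge⟩ := exists_large_slope hp hT b₁
  have hnot : ¬ Icc b₁ b₂ ⊆ A ∪ B := fun hsub => by
    obtain ⟨b, -, hbA, x, hx, hbB⟩ := isPreconnected_Icc A B hAo hBo hsub
      ⟨b₁, left_mem_Icc.2 hb₂, hsmall b₁ hb₁ le_rfl _ _ (hUV b₁) (hU _) (hV _)⟩
      ⟨b₂, right_mem_Icc.2 hb₂, hlarge _ _ (hUV b₂) (hU _) (hV _)⟩
    exact absurd (hbA x hx) (not_lt.2 hbB.le)
  obtain ⟨b, hb, hbn⟩ := not_subset.1 hnot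
  have hb0 : 0 < b := hb₁.trans_le hb.1
  simp only [hA, hB, mem_union, mem_ofPred_eq, not_or, not_forall, not_exists, not_and, not_lt]
    at hbn
  obtain ⟨⟨x, hx, hVx⟩, hge⟩ := hbn
  have hVx0 : V b x = 0 := le_antisymm hVx (hge x hx)
  refine ⟨U b, V b, hUV b, hU b, ?_, by rw [hV]; exact hb0.ne'⟩
  -- For this slope `v ≥ 0` has a zero. At an interior zero `v` is minimal, so `force` vanishes and
  -- `u` is an equilibrium; the energy would be nonpositive, whereas it equals `b²/2 > 0`. So the
  -- zero is at `T`.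
  rcases hx.2.eq_or_lt with rfl | hxT
  · exact hVx0
  exfalso
  have hx0 : 0 < x := by
    rcases hx.1.eq_or_lt with rfl | h
    · rw [hV] at hVx0; exact absurd hVx0 hb0.ne'
    · exact h
  have hder : HasDerivAt (V b) (force p (U b x)) x :=
    (hUV b x hx).2.hasDerivAt (Icc_mem_nhds hx0 hxT)
  have hmin : IsLocalMin (V b) x := by
    filter_upwards [Icc_mem_nhds hx0 hxT] with y hy
    rw [hVx0]; exact hge y hy
  have hf0 : force p (U b x) = 0 := hmin.hasDerivAt_eq_zero hder
  have hen := (hUV b).energy_eq_energy hp (convex_Icc _ _) hx (left_mem_Icc.2 hT.le)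
  rw [hU, hV, hVx0, energy_zero_left hp, energy_eq hp] at hen
  have hf1 : U b x ^ 2 = |U b x| ^ (p - 2) * U b x ^ 2 := by
    have : U b x * force p (U b x) = 0 := by rw [hf0, mul_zero]
    unfold force at this
    linarith
  have h1 : |U b x| ^ (p - 2) * U b x ^ 2 / p ≤ U b x ^ 2 / 2 := by
    rw [← hf1]; gcongr
  nlinarith [pow_pos hb0 2]

/-- The Dirichlet problem `u(0) = u(T) = 0` has a nontrivial solution. -/
theorem exists_isSol_dirichlet (hp : 2 < p) {T : ℝ} (hT : 0 < T) :
    ∃ u v : ℝ → ℝ, IsSol p (Icc 0 T) u v ∧ u 0 = 0 ∧ u T = 0 ∧ v 0 ≠ 0 := by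
  -- Solve the mixed problem on half the interval and continue the solution. Its derivative vanishes
  -- at `T/2`, so by uniqueness it is symmetric about `T/2` and returns to zero at `T`.
  obtain ⟨u₁, v₁, h₁, hu₁, hv₁, hne⟩ := exists_isSol_mixed hp (half_pos hT)
  obtain ⟨u, v, hu, hv, h⟩ := exists_isSol hp hT.le 0 (v₁ 0)
  have hmid : v (T / 2) = 0 := by
    rw [← hv₁]
    exact ((h.mono (Icc_subset_Icc_right (by linarith))).eq_of_eq hp h₁ (by rw [hu, hu₁]) hv
      (right_mem_Icc.2 (half_pos hT).le)).2
  have hr : IsSol p (Icc 0 (T / 2)) _ _ :=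
    h.comp_const_add (T / 2) fun x hx => ⟨by linarith [hx.1], by linarith [hx.2]⟩
  have hl : IsSol p (Icc 0 (T / 2)) _ _ :=
    h.comp_const_sub (T / 2) fun x hx => ⟨by linarith [hx.2], by linarith [hx.1]⟩
  have := (hr.eq_of_eq hp hl (by simp) (by simp [hmid]) (right_mem_Icc.2 (half_pos hT).le)).1
  simp only [add_halves, sub_self, hu] at this
  exact ⟨u, v, h, hu, this, by rw [hv]; exact hne⟩

/-! ### Small solutions -/

/-- The derivative of `u v` is `v² + (1 - |u|^(p-2)) u²`, nonnegative for `|u| ≤ 1`. Since `u v` is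
half the derivative of `u²`, this convexity lets the endpoints control small solutions. -/
theorem IsSol.monotone_mul_deriv (hp : 2 < p) {T : ℝ} {u v : ℝ → ℝ} (h : IsSol p (Icc 0 T) u v)
    (hu : ∀ x ∈ Icc 0 T, |u x| ≤ 1) {x y : ℝ} (hx : 0 ≤ x) (hxy : x ≤ y) (hy : y ≤ T) :
    u x * v x ≤ u y * v y := by
  have hs : Icc x y ⊆ Icc 0 T := Icc_subset_Icc hx hy
  have := mul_sub_le_sub_of_le_deriv (m := 0) hxy hs
    (fun z hz => (h z hz).1.mul (h z hz).2) fun z hz => by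
      have h1 := rpow_sub_two_le_one hp (hu z (hs hz))
      have h2 : v z * v z + u z * force p (u z) = v z ^ 2 + (1 - |u z| ^ (p - 2)) * u z ^ 2 := by
        unfold force; ring
      rw [h2]
      have := mul_nonneg (sub_nonneg.2 h1) (sq_nonneg (u z))
      positivity
  simp only [Pi.mul_apply] at this
  linarith

/-- By monotonicity `u v ≤ 0` on all of `[0, x]`, so `u²` decreases there. -/
theorem IsSol.abs_le_left (hp : 2 < p) {T : ℝ} {u v : ℝ → ℝ} (h : IsSol p (Icc 0 T) u v)
    (hu : ∀ x ∈ Icc 0 T, |u x| ≤ 1) {x : ℝ} (hx : x ∈ Icc 0 T) (hle : u x * v x ≤ 0) :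
    |u x| ≤ |u 0| := by
  have := sub_le_mul_sub_of_deriv_le (m := 0) hx.1 (Icc_subset_Icc_right hx.2)
    (fun z hz => (h z hz).1.mul (h z hz).1) fun z hz => by
      have := h.monotone_mul_deriv hp hu hz.1 hz.2 hx.2
      linarith
  simp only [Pi.mul_apply] at this
  exact sq_le_sq.1 (by nlinarith)

theorem IsSol.abs_le_right (hp : 2 < p) {T : ℝ} {u v : ℝ → ℝ} (h : IsSol p (Icc 0 T) u v)
    (hu : ∀ x ∈ Icc 0 T, |u x| ≤ 1) {x : ℝ} (hx : x ∈ Icc 0 T) (hle : 0 ≤ u x * v x) :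
    |u x| ≤ |u T| := by
  have := mul_sub_le_sub_of_le_deriv (m := 0) hx.2 (Icc_subset_Icc_left hx.1)
    (fun z hz => (h z hz).1.mul (h z hz).1) fun z hz => by
      have := h.monotone_mul_deriv hp hu hx.1 hz.1 hz.2
      linarith
  simp only [Pi.mul_apply] at this
  exact sq_le_sq.1 (by nlinarith)

/-- Comparison of a small solution with the solution `cosh (c - x)` of the linear equation. -/
theorem IsSol.abs_wronskian_le (hp : 2 < p) {T a c : ℝ} (hT : 0 ≤ T) (hc : T ≤ 2 * c)
    {u v : ℝ → ℝ} (h : IsSol p (Icc 0 T) u v) (hu : ∀ x ∈ Icc 0 T, |u x| ≤ |a|) :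
    |(v T * Real.cosh (c - T) + u T * Real.sinh (c - T)) -
      (v 0 * Real.cosh c + u 0 * Real.sinh c)| ≤ |a| ^ (p - 2) * |a| * Real.cosh c * T := by
  -- The linear terms cancel in this derivative and only the nonlinear one remains. The assumption
  -- `T ≤ 2 * c` gives `|c - x| ≤ c`, whence `cosh (c - x) ≤ cosh c`.
  have hder : ∀ x ∈ Icc 0 T, HasDerivWithinAt
      (fun y => v y * Real.cosh (c - y) + u y * Real.sinh (c - y))
      (-(|u x| ^ (p - 2) * u x * Real.cosh (c - x))) (Icc 0 T) x := fun x hx => by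
    have h0 : HasDerivAt (fun y => c - y) (-1) x := by simpa using (hasDerivAt_id x).const_sub c
    have h1 : HasDerivAt (fun y => Real.cosh (c - y)) (Real.sinh (c - x) * (-1)) x :=
      (Real.hasDerivAt_cosh (c - x)).comp x h0
    have h2 : HasDerivAt (fun y => Real.sinh (c - y)) (Real.cosh (c - x) * (-1)) x :=
      (Real.hasDerivAt_sinh (c - x)).comp x h0
    refine (((h x hx).2.mul h1.hasDerivWithinAt).add
      ((h x hx).1.mul h2.hasDerivWithinAt)).congr_deriv ?_
    unfold force; ring
  have := (convex_Icc 0 T).norm_image_sub_le_of_norm_hasDerivWithin_le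
    (C := |a| ^ (p - 2) * |a| * Real.cosh c) hder (fun x hx => by
      rw [norm_neg, norm_mul, norm_mul, Real.norm_eq_abs, Real.norm_eq_abs, Real.norm_eq_abs,
        abs_of_nonneg (Real.rpow_nonneg (abs_nonneg (u x)) _), abs_of_pos (Real.cosh_pos _)]
      have h1 : |u x| ^ (p - 2) ≤ |a| ^ (p - 2) :=
        Real.rpow_le_rpow (abs_nonneg _) (hu x hx) (by linarith)
      have h2 : Real.cosh (c - x) ≤ Real.cosh c := by
        rw [Real.cosh_le_cosh, abs_le, abs_of_nonneg (by linarith : 0 ≤ c)]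
        constructor <;> linarith [hx.1, hx.2]
      have h3 := hu x hx
      gcongr)
    (left_mem_Icc.2 hT) (right_mem_Icc.2 hT)
  simpa [abs_of_nonneg hT] using this

theorem IsSol.abs_le_of_neumann (hp : 2 < p) {T : ℝ} {u v : ℝ → ℝ}
    (h : IsSol p (Icc 0 T) u v) (hu : ∀ x ∈ Icc 0 T, |u x| ≤ 1) (hv : v T = 0) :
    ∀ x ∈ Icc 0 T, |u x| ≤ |u 0| := fun x hx => h.abs_le_left hp hu hx (by
  have := h.monotone_mul_deriv hp hu hx.1 hx.2 le_rfl
  rwa [hv, mul_zero] at this)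

/-- The sign of `u v` at `x` decides which endpoint dominates, and both endpoints carry the same
value. -/
theorem IsSol.abs_le_of_loop (hp : 2 < p) {T : ℝ} {u v : ℝ → ℝ}
    (h : IsSol p (Icc 0 T) u v) (hu : ∀ x ∈ Icc 0 T, |u x| ≤ 1) (huT : u T = u 0) :
    ∀ x ∈ Icc 0 T, |u x| ≤ |u 0| := fun x hx => by
  rcases le_total (u x * v x) 0 with hle | hle
  · exact h.abs_le_left hp hu hx hle
  · exact huT ▸ h.abs_le_right hp hu hx hle

/-- The Dirichlet-to-Neumann map of a pendant, for small solutions. -/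
theorem IsSol.abs_deriv_add_tanh_le (hp : 2 < p) {T : ℝ} (hT : 0 ≤ T) {u v : ℝ → ℝ}
    (h : IsSol p (Icc 0 T) u v) (hu : ∀ x ∈ Icc 0 T, |u x| ≤ 1) (hv : v T = 0) :
    |v 0 + u 0 * Real.tanh T| ≤ |u 0| ^ (p - 2) * |u 0| * T := by
  -- With `c = T` the comparison function `cosh (T - x)` also has zero derivative at the tip, so no
  -- boundary term survives there.
  have h1 := h.abs_wronskian_le hp hT (c := T) (by linarith) (h.abs_le_of_neumann hp hu hv)
  have hc := Real.cosh_pos T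
  rw [hv, sub_self, Real.sinh_zero, zero_mul, mul_zero, zero_add, zero_sub, abs_neg] at h1
  have h2 : v 0 * Real.cosh T + u 0 * Real.sinh T = (v 0 + u 0 * Real.tanh T) * Real.cosh T := by
    rw [Real.tanh_eq_sinh_div_cosh]; field_simp
  rw [h2, abs_mul, abs_of_pos hc] at h1
  refine le_of_mul_le_mul_right (h1.trans_eq ?_) hc
  ring

/-- The Dirichlet-to-Neumann map of a loop, for small solutions. -/
theorem IsSol.abs_deriv_sub_deriv_add_tanh_le (hp : 2 < p) {T : ℝ} (hT : 0 ≤ T) {u v : ℝ → ℝ}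
    (h : IsSol p (Icc 0 T) u v) (hu : ∀ x ∈ Icc 0 T, |u x| ≤ 1) (huT : u T = u 0) :
    |v 0 - v T + u 0 * (2 * Real.tanh (T / 2))| ≤ |u 0| ^ (p - 2) * |u 0| * T := by
  -- With `c = T / 2` the comparison function is symmetric on the loop, so the two ends combine into
  -- `v 0 - v T`.
  have h1 := h.abs_wronskian_le hp hT (c := T / 2) (by linarith) (h.abs_le_of_loop hp hu huT)
  have hc := Real.cosh_pos (T / 2)
  have h0 : T / 2 - T = -(T / 2) := by ring
  rw [huT, h0, Real.cosh_neg, Real.sinh_neg, ← abs_neg] at h1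
  have h2 : -(v T * Real.cosh (T / 2) + u 0 * -Real.sinh (T / 2) -
      (v 0 * Real.cosh (T / 2) + u 0 * Real.sinh (T / 2))) =
      (v 0 - v T + u 0 * (2 * Real.tanh (T / 2))) * Real.cosh (T / 2) := by
    rw [Real.tanh_eq_sinh_div_cosh]; field_simp; ring
  rw [h2, abs_mul, abs_of_pos hc] at h1
  refine le_of_mul_le_mul_right (h1.trans_eq ?_) hc
  ring

/-- Lipschitz dependence, applied against the zero solution, supplies the standing assumption `|u| ≤
1` of the estimates above. -/
theorem eventually_abs_le_one (hp : 2 < p) {T : ℝ} (hT : 0 ≤ T) {ι : Type*} {l : Filter ι}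
    {U V : ι → ℝ → ℝ} (hUV : ∀ n, IsSol p (Icc 0 T) (U n) (V n))
    (hU : Tendsto (fun n => U n 0) l (𝓝 0)) (hV : Tendsto (fun n => V n 0) l (𝓝 0)) :
    ∀ᶠ n in l, ∀ x ∈ Icc 0 T, |U n x| ≤ 1 := by
  obtain ⟨C, hC0, hC⟩ := exists_dist_le hp 1 hT
  have hz : energy p 0 0 = 0 := by rw [energy_zero_left hp]; simp
  have hE : ∀ᶠ n in l, energy p (U n 0) (V n 0) < 1 := by
    have := ((continuous_energy hp).tendsto (0, 0)).comp (hU.prodMk_nhds hV)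
    rw [hz] at this
    exact this.eventually (gt_mem_nhds one_pos)
  have hlim : Tendsto (fun n => C * max |U n 0| |V n 0|) l (𝓝 0) := by
    simpa using (hU.abs.max hV.abs).const_mul C
  filter_upwards [hE, hlim.eventually (gt_mem_nhds one_pos)] with n h1 h2 x hx
  have := hC _ _ _ _ (hUV n) (isSol_zero _) h1.le (by rw [hz]; norm_num) x hx
  simp only [sub_zero] at this
  exact (le_max_left _ _).trans (this.trans h2.le)

/-! ### The soliton -/

/-- The height `(p/2)^(1/(p-2))` of the soliton. -/
noncomputable def solitonHeight (p : ℝ) : ℝ := (p / 2) ^ (1 / (p - 2))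

/-- The soliton, the positive even solution of `u'' = u - |u|^(p-2) u` in `H¹(ℝ)`. -/
noncomputable def soliton (p x : ℝ) : ℝ :=
  solitonHeight p * Real.cosh ((p - 2) / 2 * x) ^ (-(2 / (p - 2)))

/-- The derivative of the soliton. -/
noncomputable def solitonDeriv (p x : ℝ) : ℝ := -(soliton p x * Real.tanh ((p - 2) / 2 * x))

theorem solitonHeight_pos (hp : 2 < p) : 0 < solitonHeight p :=
  Real.rpow_pos_of_pos (by linarith) _

theorem soliton_pos (hp : 2 < p) (x : ℝ) : 0 < soliton p x :=
  mul_pos (solitonHeight_pos hp) (Real.rpow_pos_of_pos (Real.cosh_pos _) _)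

theorem soliton_zero : soliton p 0 = solitonHeight p := by simp [soliton]

theorem soliton_neg (x : ℝ) : soliton p (-x) = soliton p x := by
  simp only [soliton, mul_neg, Real.cosh_neg]

theorem solitonDeriv_neg (x : ℝ) : solitonDeriv p (-x) = -solitonDeriv p x := by
  simp only [solitonDeriv, soliton_neg, mul_neg, Real.tanh_neg]

theorem solitonHeight_rpow (hp : 2 < p) : solitonHeight p ^ (p - 2) = p / 2 := by
  rw [solitonHeight, ← Real.rpow_mul (by linarith), one_div, inv_mul_cancel₀ (by linarith),
    Real.rpow_one]

/-- The exponent in the soliton is chosen so that the power `p - 2` leaves just `cosh⁻²`; the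
equation and the zero-energy identity then reduce to `tanh² = 1 - cosh⁻²`. -/
theorem soliton_rpow (hp : 2 < p) (x : ℝ) :
    |soliton p x| ^ (p - 2) = p / 2 / Real.cosh ((p - 2) / 2 * x) ^ 2 := by
  have hc := Real.cosh_pos ((p - 2) / 2 * x)
  have hp2 : p - 2 ≠ 0 := by linarith
  rw [abs_of_pos (soliton_pos hp x), soliton, Real.mul_rpow (solitonHeight_pos hp).le
    (Real.rpow_nonneg hc.le _), solitonHeight_rpow hp, ← Real.rpow_mul hc.le,
    neg_mul, div_mul_cancel₀ _ hp2, Real.rpow_neg hc.le, Real.rpow_two, ← div_eq_mul_inv]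

theorem tanh_sq (y : ℝ) : Real.tanh y ^ 2 = 1 - 1 / Real.cosh y ^ 2 := by
  have hc := (Real.cosh_pos y).ne'
  rw [Real.tanh_eq_sinh_div_cosh, div_pow, Real.sinh_sq]
  field_simp

theorem hasDerivAt_soliton (hp : 2 < p) (x : ℝ) :
    HasDerivAt (soliton p) (solitonDeriv p x) x := by
  have hc := Real.cosh_pos ((p - 2) / 2 * x)
  have hp2 : p - 2 ≠ 0 := by linarith
  have h0 : HasDerivAt (fun y => (p - 2) / 2 * y) ((p - 2) / 2) x := by
    simpa using (hasDerivAt_id x).const_mul ((p - 2) / 2)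
  have h1 : HasDerivAt (fun y => Real.cosh ((p - 2) / 2 * y))
      (Real.sinh ((p - 2) / 2 * x) * ((p - 2) / 2)) x := (Real.hasDerivAt_cosh _).comp x h0
  refine ((h1.rpow_const (p := -(2 / (p - 2))) (Or.inl hc.ne')).const_mul
    (solitonHeight p)).congr_deriv ?_
  rw [solitonDeriv, soliton, Real.tanh_eq_sinh_div_cosh, Real.rpow_sub_one hc.ne']
  field_simp

theorem hasDerivAt_solitonDeriv (hp : 2 < p) (x : ℝ) :
    HasDerivAt (solitonDeriv p) (force p (soliton p x)) x := by
  have hc := (Real.cosh_pos ((p - 2) / 2 * x)).ne'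
  have h0 : HasDerivAt (fun y => (p - 2) / 2 * y) ((p - 2) / 2) x := by
    simpa using (hasDerivAt_id x).const_mul ((p - 2) / 2)
  have h1 : HasDerivAt (fun y => Real.cosh ((p - 2) / 2 * y))
      (Real.sinh ((p - 2) / 2 * x) * ((p - 2) / 2)) x := (Real.hasDerivAt_cosh _).comp x h0
  have h2 : HasDerivAt (fun y => Real.sinh ((p - 2) / 2 * y))
      (Real.cosh ((p - 2) / 2 * x) * ((p - 2) / 2)) x := (Real.hasDerivAt_sinh _).comp x h0
  have h3 : HasDerivAt (fun y => Real.tanh ((p - 2) / 2 * y))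
      ((p - 2) / 2 / Real.cosh ((p - 2) / 2 * x) ^ 2) x := by
    have := h2.div h1 hc
    have e : (fun y => Real.tanh ((p - 2) / 2 * y)) =
        (fun y => Real.sinh ((p - 2) / 2 * y)) / fun y => Real.cosh ((p - 2) / 2 * y) := by
      ext y; exact Real.tanh_eq_sinh_div_cosh _
    rw [e]
    refine this.congr_deriv ?_
    have := Real.cosh_sq ((p - 2) / 2 * x)
    congr 1
    linear_combination (p - 2) / 2 * this
  refine ((hasDerivAt_soliton hp x).mul h3).neg.congr_deriv ?_
  rw [force, soliton_rpow hp, solitonDeriv]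
  have := tanh_sq ((p - 2) / 2 * x)
  linear_combination soliton p x * this

theorem soliton_rpow' (hp : 2 < p) (x : ℝ) :
    |soliton p x| ^ (p - 2) = p / 2 * (1 - Real.tanh ((p - 2) / 2 * x) ^ 2) := by
  rw [soliton_rpow hp, tanh_sq]; ring

theorem energy_soliton (hp : 2 < p) (x : ℝ) :
    energy p (soliton p x) (solitonDeriv p x) = 0 := by
  rw [energy_eq hp, soliton_rpow' hp, solitonDeriv]
  have : p ≠ 0 := by linarith
  field_simp
  ring

/-- From `cosh y ≥ exp y / 2`: the power `-2/(p-2)` turns `exp ((p-2)x/2)` into `exp (-x)`. -/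
theorem soliton_le (hp : 2 < p) (x : ℝ) :
    soliton p x ≤ solitonHeight p * 2 ^ (2 / (p - 2)) * Real.exp (-x) := by
  have hp2 : 0 < p - 2 := by linarith
  have h1 : Real.exp ((p - 2) / 2 * x) / 2 ≤ Real.cosh ((p - 2) / 2 * x) := by
    rw [Real.cosh_eq]
    have := Real.exp_pos (-((p - 2) / 2 * x))
    linarith
  rw [soliton, mul_assoc]
  refine mul_le_mul_of_nonneg_left ?_ (solitonHeight_pos hp).le
  calc Real.cosh ((p - 2) / 2 * x) ^ (-(2 / (p - 2)))
      ≤ (Real.exp ((p - 2) / 2 * x) / 2) ^ (-(2 / (p - 2))) :=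
        Real.rpow_le_rpow_of_nonpos (by positivity) h1 (by
          rw [neg_nonpos]; positivity)
    _ = 2 ^ (2 / (p - 2)) * Real.exp (-x) := by
        rw [Real.div_rpow (Real.exp_pos _).le (by norm_num), ← Real.exp_mul,
          Real.rpow_neg (by norm_num : (0:ℝ) ≤ 2), div_inv_eq_mul, mul_comm]
        congr 2
        field_simp

theorem abs_solitonDeriv_le (hp : 2 < p) (x : ℝ) : |solitonDeriv p x| ≤ soliton p x := by
  rw [solitonDeriv, abs_neg, abs_mul, abs_of_pos (soliton_pos hp x)]
  exact mul_le_of_le_one_right (soliton_pos hp x).le (Real.abs_tanh_lt_one _).le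

theorem continuous_soliton (hp : 2 < p) : Continuous (soliton p) :=
  continuous_iff_continuousAt.2 fun x => (hasDerivAt_soliton hp x).continuousAt

theorem continuous_solitonDeriv (hp : 2 < p) : Continuous (solitonDeriv p) :=
  continuous_iff_continuousAt.2 fun x => (hasDerivAt_solitonDeriv hp x).continuousAt

theorem exists_soliton_eq (hp : 2 < p) {a : ℝ} (ha : 0 < a) (ha' : a ≤ solitonHeight p) :
    ∃ s, soliton p s = a := by
  have hlim : Tendsto (soliton p) atTop (𝓝 0) := by
    refine squeeze_zero (fun x => (soliton_pos hp x).le) (soliton_le hp) ?_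
    simpa using Real.tendsto_exp_neg_atTop_nhds_zero.const_mul
      (solitonHeight p * 2 ^ (2 / (p - 2)))
  obtain ⟨t, ht0, hta⟩ := ((eventually_ge_atTop 0).and (hlim.eventually (gt_mem_nhds ha))).exists
  obtain ⟨s, -, hs⟩ := intermediate_value_Icc' ht0 (continuous_soliton hp).continuousOn
    (show a ∈ Icc (soliton p t) (soliton p 0) from ⟨hta.le, by rwa [soliton_zero]⟩)
  exact ⟨s, hs⟩

theorem rpow_le_of_energy_zero (hp : 2 < p) {a b : ℝ} (ha : a ≠ 0) (h : energy p a b = 0) :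
    |a| ^ (p - 2) ≤ p / 2 := by
  rw [energy_eq hp] at h
  have hp0 : 0 < p := by linarith
  have ha2 : 0 < a ^ 2 := by positivity
  have h1 : |a| ^ (p - 2) * a ^ 2 / p ≤ a ^ 2 / 2 := by nlinarith [sq_nonneg b]
  rw [div_le_iff₀ hp0] at h1
  nlinarith

theorem abs_le_solitonHeight (hp : 2 < p) {a b : ℝ} (h : energy p a b = 0) :
    |a| ≤ solitonHeight p := by
  rcases eq_or_ne a 0 with rfl | ha
  · simpa using (solitonHeight_pos hp).le
  · have := rpow_le_of_energy_zero hp ha h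
    rw [← solitonHeight_rpow hp] at this
    exact (Real.rpow_le_rpow_iff (abs_nonneg _) (solitonHeight_pos hp).le (by linarith)).1 this

/-- Cauchy data of vanishing energy lie on the orbit of the soliton. -/
theorem exists_soliton_data (hp : 2 < p) {a b : ℝ} (ha : a ≠ 0) (h : energy p a b = 0) :
    ∃ s, (a = soliton p s ∧ b = solitonDeriv p s) ∨ (a = -soliton p s ∧ b = -solitonDeriv p s) := by
  obtain ⟨s, hs⟩ := exists_soliton_eq hp (abs_pos.2 ha) (abs_le_solitonHeight hp h)
  have hb : b ^ 2 = solitonDeriv p s ^ 2 := by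
    have h1 := energy_soliton hp s
    rw [hs] at h1
    rw [energy_eq hp] at h h1
    rw [abs_abs, sq_abs] at h1
    linarith
  -- The soliton parameter fixes `|a|` and, by zero energy, `b²`. The four sign choices are realized
  -- by the reflection `s ↦ -s` and a global change of sign.
  rcases sq_eq_sq_iff_eq_or_eq_neg.1 hb with hb | hb <;> rcases abs_eq_abs.1
    ((abs_of_pos (soliton_pos hp s)).trans hs).symm with ha' | ha'
  · exact ⟨s, Or.inl ⟨ha', hb⟩⟩
  · exact ⟨-s, Or.inr ⟨by rw [soliton_neg, ha'], by rw [solitonDeriv_neg, hb, neg_neg]⟩⟩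
  · exact ⟨-s, Or.inl ⟨by rw [soliton_neg, ha'], by rw [solitonDeriv_neg, hb]⟩⟩
  · exact ⟨s, Or.inr ⟨ha', hb⟩⟩

theorem memLp_two_of_abs_le_exp {f : ℝ → ℝ} (hf : Continuous f) {C : ℝ}
    (h : ∀ x, |f x| ≤ C * Real.exp (-x)) : MemLp f 2 (volume.restrict (Ioi 0)) := by
  have h1 : MemLp (fun x => C * Real.exp (-x)) 2 (volume.restrict (Ioi (0:ℝ))) := by
    rw [memLp_two_iff_integrable_sq (by fun_prop)]
    have := (exp_neg_integrableOn_Ioi 0 (two_pos (α := ℝ))).const_mul (C ^ 2)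
    refine this.congr (Eventually.of_forall fun x => ?_)
    simp only
    rw [mul_pow, ← Real.exp_nat_mul]
    congr 2; push_cast; ring
  exact h1.mono hf.aestronglyMeasurable (Eventually.of_forall fun x => (h x).trans (le_abs_self _))

/-- Cauchy data of vanishing energy give solutions in `H¹` of the half-line. -/
theorem exists_halfLine_isSol (hp : 2 < p) {a b : ℝ} (h : energy p a b = 0) :
    ∃ u v : ℝ → ℝ, u 0 = a ∧ v 0 = b ∧ IsSol p (Ici 0) u v ∧
      MemLp u 2 (volume.restrict (Ioi 0)) ∧ MemLp v 2 (volume.restrict (Ioi 0)) := by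
  rcases eq_or_ne a 0 with rfl | ha
  · rw [energy_zero_left hp] at h
    refine ⟨fun _ => 0, fun _ => 0, rfl, ?_, isSol_zero _, MemLp.zero', MemLp.zero'⟩
    exact (pow_eq_zero_iff two_ne_zero).1 (by linarith) |>.symm
  · obtain ⟨s, hs⟩ := exists_soliton_data hp ha h
    have hsol : IsSol p (Ici 0) (fun x => soliton p (s + x)) (fun x => solitonDeriv p (s + x)) :=
      IsSol.comp_const_add (s := univ) (fun x _ => ⟨(hasDerivAt_soliton hp x).hasDerivWithinAt,
        (hasDerivAt_solitonDeriv hp x).hasDerivWithinAt⟩) s (mapsTo_univ _ _)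
    have hle : ∀ x, |soliton p (s + x)| ≤
        solitonHeight p * 2 ^ (2 / (p - 2)) * Real.exp (-s) * Real.exp (-x) := fun x => by
      rw [abs_of_pos (soliton_pos hp _), mul_assoc, ← Real.exp_add, ← neg_add]
      exact soliton_le hp _
    have h1 : MemLp (fun x => soliton p (s + x)) 2 (volume.restrict (Ioi 0)) :=
      memLp_two_of_abs_le_exp ((continuous_soliton hp).comp (by fun_prop)) hle
    have h2 : MemLp (fun x => solitonDeriv p (s + x)) 2 (volume.restrict (Ioi 0)) :=
      memLp_two_of_abs_le_exp ((continuous_solitonDeriv hp).comp (by fun_prop)) fun x =>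
        (abs_solitonDeriv_le hp _).trans ((le_abs_self _).trans (hle x))
    rcases hs with ⟨ha, hb⟩ | ⟨ha, hb⟩
    · exact ⟨_, _, by simp [ha], by simp [hb], hsol, h1, h2⟩
    · exact ⟨_, _, by simp [ha], by simp [hb], hsol.neg, h1.neg, h2.neg⟩

/-! ### Indefinite integrals and weak derivatives -/

/-- `F` is an indefinite integral of `f` on the interval `t`. -/
def IsPrimOn (t : Set ℝ) (F f : ℝ → ℝ) : Prop :=
  ∀ a ∈ t, ∀ b ∈ t, a ≤ b → IntervalIntegrable f volume a b ∧ F b = F a + ∫ x in a..b, f x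

theorem IsPrimOn.mono {s t : Set ℝ} {F f : ℝ → ℝ} (h : IsPrimOn t F f) (hst : s ⊆ t) :
    IsPrimOn s F f := fun a ha b hb => h a (hst ha) b (hst hb)

/-- `F` is controlled only on `[a, b]`, so it is replaced by the explicit integral `G`, to which
Lebesgue differentiation applies almost everywhere. -/
theorem IsPrimOn.absolutelyContinuous {F f : ℝ → ℝ} {a b : ℝ} (hab : a ≤ b)
    (h : IsPrimOn (Icc a b) F f) :
    ∃ G : ℝ → ℝ, AbsolutelyContinuousOnInterval G a b ∧ EqOn F G (Icc a b) ∧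
      ∀ᵐ x, x ∈ uIcc a b → HasDerivAt G (f x) x := by
  obtain ⟨hi, -⟩ := h a (left_mem_Icc.2 hab) b (right_mem_Icc.2 hab) hab
  refine ⟨fun x => F a + ∫ y in a..x, f y, ?_, fun x hx =>
    (h a (left_mem_Icc.2 hab) x hx hx.1).2, ?_⟩
  · exact (contDiff_const.contDiffOn.absolutelyContinuousOnInterval).add
      (hi.absolutelyContinuousOnInterval_intervalIntegral left_mem_uIcc)
  · filter_upwards [hi.ae_hasDerivAt_integral] with x hx hxm
    exact (hx hxm a left_mem_uIcc).const_add _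

/-- Integration by parts for absolutely continuous functions. It is needed in this generality
because test functions are merely `H¹`. -/
theorem IsPrimOn.mul {t : Set ℝ} (ht : t.OrdConnected) {F f W w : ℝ → ℝ}
    (hF : IsPrimOn t F f) (hW : IsPrimOn t W w) :
    IsPrimOn t (fun x => F x * W x) (fun x => f x * W x + F x * w x) := by
  intro a ha b hb hab
  have hsub : Icc a b ⊆ t := ht.out ha hb
  obtain ⟨G, hGa, hGe, hGd⟩ := (hF.mono hsub).absolutelyContinuous hab
  obtain ⟨V, hVa, hVe, hVd⟩ := (hW.mono hsub).absolutelyContinuous hab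
  have hu : uIcc a b = Icc a b := uIcc_of_le hab
  have hcF : ContinuousOn F (uIcc a b) := hGa.continuousOn.congr (hu ▸ hGe)
  have hcW : ContinuousOn W (uIcc a b) := hVa.continuousOn.congr (hu ▸ hVe)
  refine ⟨((hF a ha b hb hab).1.mul_continuousOn hcW).add
    ((hW a ha b hb hab).1.continuousOn_mul hcF), ?_⟩
  have h := hGa.integral_deriv_mul_eq_sub hVa
  rw [← hGe (left_mem_Icc.2 hab), ← hGe (right_mem_Icc.2 hab), ← hVe (left_mem_Icc.2 hab),
    ← hVe (right_mem_Icc.2 hab)] at h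
  beta_reduce
  rw [show F b * W b = F a * W a + (F b * W b - F a * W a) by ring, ← h]
  congr 1
  refine intervalIntegral.integral_congr_ae ?_
  filter_upwards [hGd, hVd] with x h1 h2 hx
  have hx' : x ∈ uIcc a b := uIoc_subset_uIcc hx
  rw [(h1 hx').deriv, (h2 hx').deriv, hGe (hu ▸ hx'), hVe (hu ▸ hx')]

theorem isPrimOn_of_hasDerivWithinAt {t : Set ℝ} (ht : t.OrdConnected) {F f : ℝ → ℝ}
    (hF : ∀ x ∈ t, HasDerivWithinAt F (f x) t x) (hf : ContinuousOn f t) : IsPrimOn t F f := by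
  intro a ha b hb hab
  have hsub : Icc a b ⊆ t := ht.out ha hb
  have hi : IntervalIntegrable f volume a b :=
    (hf.mono ((uIcc_of_le hab).symm ▸ hsub)).intervalIntegrable
  refine ⟨hi, ?_⟩
  rw [intervalIntegral.integral_eq_sub_of_hasDerivAt_of_le hab
    (fun x hx => ((hF x (hsub hx)).mono hsub).continuousWithinAt) (fun x hx =>
      ((hF x (hsub (Ioo_subset_Icc_self hx))).mono hsub).hasDerivAt (Icc_mem_nhds hx.1 hx.2)) hi]
  ring

/-- Used to turn integrals over `s` of compactly supported functions into interval integrals with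
vanishing boundary values. -/
theorem exists_Icc_of_isCompact {s K : Set ℝ} (hs : IsOpen s) (hsc : s.OrdConnected)
    (hne : s.Nonempty) (hK : IsCompact K) (hKs : K ⊆ s) :
    ∃ a b, a < b ∧ Icc a b ⊆ s ∧ K ⊆ Ioo a b := by
  obtain ⟨z, hz⟩ := hne
  have hK' : IsCompact (insert z K) := hK.insert z
  have hKs' : insert z K ⊆ s := insert_subset hz hKs
  obtain ⟨α, hα, hαmin⟩ := hK'.exists_isLeast (insert_nonempty _ _)
  obtain ⟨β, hβ, hβmax⟩ := hK'.exists_isGreatest (insert_nonempty _ _)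
  obtain ⟨a, b', ha, hab⟩ := mem_nhds_iff_exists_Ioo_subset.1 (hs.mem_nhds (hKs' hα))
  obtain ⟨a', b, hb, hab'⟩ := mem_nhds_iff_exists_Ioo_subset.1 (hs.mem_nhds (hKs' hβ))
  obtain ⟨x, hx1, hx2⟩ := exists_between ha.1
  obtain ⟨y, hy1, hy2⟩ := exists_between hb.2
  have hαβ : α ≤ β := hαmin hβ
  refine ⟨x, y, by linarith, hsc.out (hab ⟨hx1, hx2.trans ha.2⟩) (hab' ⟨hb.1.trans hy1, hy2⟩),
    fun k hk => ⟨hx2.trans_le (hαmin (mem_insert_of_mem _ hk)),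
      (hβmax (mem_insert_of_mem _ hk)).trans_lt hy1⟩⟩

theorem setIntegral_eq_intervalIntegral {s : Set ℝ} (hs : MeasurableSet s) {a b : ℝ}
    (hab : a ≤ b) (hsub : Icc a b ⊆ s) {f : ℝ → ℝ} (hf : ∀ x ∉ Ioo a b, f x = 0) :
    ∫ x in s, f x = ∫ x in a..b, f x := by
  rw [intervalIntegral.integral_of_le hab]
  exact setIntegral_eq_of_subset_of_forall_sdiff_eq_zero hs (Ioc_subset_Icc_self.trans hsub)
    fun x hx => hf x fun h => hx.2 (Ioo_subset_Ioc_self h)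

/-- An indefinite integral is weakly differentiable. -/
theorem IsPrimOn.hasWeakDerivOn {s : Set ℝ} (hs : IsOpen s) (hsc : s.OrdConnected)
    (hne : s.Nonempty) {F f : ℝ → ℝ} (h : IsPrimOn s F f) (hF : ContinuousOn F s)
    (hf : LocallyIntegrableOn f s) : HasWeakDerivOn s F f := by
  refine ⟨hF.locallyIntegrableOn hs.measurableSet, hf, fun φ hφ hφc hφs => ?_⟩
  obtain ⟨a, b, hab, hsub, hK⟩ := exists_Icc_of_isCompact hs hsc hne hφc hφs
  have h0 : ∀ x ∉ Ioo a b, φ x = 0 := fun x hx => image_eq_zero_of_notMem_tsupport fun h => hx (hK h)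
  have h1 : ∀ x ∉ Ioo a b, deriv φ x = 0 := fun x hx =>
    image_eq_zero_of_notMem_tsupport fun h => hx (hK (tsupport_deriv_subset h))
  have hφ1 : ContDiff ℝ 1 φ := hφ.of_le (by simp)
  have hφp : IsPrimOn (Icc a b) φ (deriv φ) := isPrimOn_of_hasDerivWithinAt ordConnected_Icc
    (fun x _ => ((hφ1.differentiable one_ne_zero) x).hasDerivAt.hasDerivWithinAt)
    (hφ1.continuous_deriv le_rfl).continuousOn
  rw [setIntegral_eq_intervalIntegral hs.measurableSet hab.le hsub
      (fun x hx => by rw [h1 x hx, mul_zero]),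
    setIntegral_eq_intervalIntegral hs.measurableSet hab.le hsub
      (fun x hx => by rw [h0 x hx, mul_zero])]
  have hi := (h.mono hsub).mul ordConnected_Icc hφp a (left_mem_Icc.2 hab.le) b
    (right_mem_Icc.2 hab.le) hab.le
  have hfi := (h.mono hsub a (left_mem_Icc.2 hab.le) b (right_mem_Icc.2 hab.le) hab.le).1
  have hu : uIcc a b = Icc a b := uIcc_of_le hab.le
  have hg : IntervalIntegrable (fun x => F x * deriv φ x) volume a b :=
    ((hF.mono (hu ▸ hsub)).mul (hφ1.continuous_deriv le_rfl).continuousOn).intervalIntegrable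
  have e := hi.2
  beta_reduce at e
  rw [h0 a (by simp), h0 b (by simp), mul_zero, mul_zero, zero_add,
    intervalIntegral.integral_add (hfi.mul_continuousOn hφ.continuous.continuousOn)
      hg] at e
  linarith

/-- The du Bois-Reymond lemma. -/
theorem ae_eq_const_of_forall_integral_deriv_eq_zero {s : Set ℝ} (hs : IsOpen s)
    (hsc : s.OrdConnected) (hne : s.Nonempty) {f : ℝ → ℝ} (hf : LocallyIntegrableOn f s)
    (h : ∀ φ : ℝ → ℝ, ContDiff ℝ ∞ φ → HasCompactSupport φ → tsupport φ ⊆ s →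
      ∫ x in s, f x * deriv φ x = 0) :
    ∃ c : ℝ, f =ᵐ[volume.restrict s] fun _ => c := by
  obtain ⟨z, hz⟩ := hne
  obtain ⟨ψ₀, hψs₀, hψc₀, hψ₀, hψr, hψz⟩ :=
    exists_contDiff_tsupport_subset (n := ⊤) (hs.mem_nhds hz)
  have hI : 0 < ∫ x, ψ₀ x := by
    refine (hψ₀.continuous.integral_pos_of_hasCompactSupport_nonneg_nonzero hψc₀
      (fun x => (hψr ⟨x, rfl⟩).1) (x := z) (by rw [hψz]; exact one_ne_zero))
  obtain ⟨ψ, hψs, hψc, hψ, hψI⟩ : ∃ ψ : ℝ → ℝ, tsupport ψ ⊆ s ∧ HasCompactSupport ψ ∧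
      ContDiff ℝ ∞ ψ ∧ ∫ x, ψ x = 1 := by
    refine ⟨fun x => (∫ x, ψ₀ x)⁻¹ * ψ₀ x, ?_, hψc₀.mul_left, contDiff_const.mul hψ₀, ?_⟩
    · exact (closure_mono (Function.support_mul_subset_right _ _)).trans hψs₀
    · rw [integral_const_mul, inv_mul_cancel₀ hI.ne']
  have hint : ∀ φ : ℝ → ℝ, Continuous φ → HasCompactSupport φ → tsupport φ ⊆ s →
      Integrable (fun x => f x * φ x) (volume.restrict s) := fun φ hφ hφc hφs => by
    have h1 := (hf.integrableOn_compact_subset hφs hφc).mul_continuousOn hφ.continuousOn hφc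
    have h2 : IntegrableOn (fun x => f x * φ x) s := by
      refine (integrableOn_iff_integrable_of_support_subset ?_).1 h1 |>.integrableOn
      exact (Function.support_mul_subset_right _ _).trans (subset_tsupport _)
    exact h2
  set c : ℝ := ∫ x in s, f x * ψ x with hc
  refine ⟨c, ?_⟩
  have key : ∀ᵐ x, x ∈ s → f x - c = 0 := by
    refine hs.ae_eq_zero_of_integral_contDiff_smul_eq_zero
      (hf.sub (locallyIntegrable_const c |>.locallyIntegrableOn s)) fun φ hφ hφc hφs => ?_
    set m : ℝ := ∫ x, φ x with hm
    obtain ⟨a, b, hab, hsub, hK⟩ := exists_Icc_of_isCompact hs hsc ⟨z, hz⟩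
      (hφc.isCompact.union hψc.isCompact) (union_subset hφs hψs)
    -- `θ` has integral zero, so its primitive `χ` has compact support and is an admissible test
    -- function. Testing with `χ` gives `∫ f φ = m ∫ f ψ = c ∫ φ`.
    set θ : ℝ → ℝ := fun x => φ x - m * ψ x with hθ
    have hθs : ContDiff ℝ ∞ θ := hφ.sub (contDiff_const.mul hψ)
    have hφ0 : ∀ x ∉ Ioo a b, φ x = 0 := fun x hx =>
      image_eq_zero_of_notMem_tsupport fun h => hx (hK (Or.inl h))
    have hψ0 : ∀ x ∉ Ioo a b, ψ x = 0 := fun x hx =>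
      image_eq_zero_of_notMem_tsupport fun h => hx (hK (Or.inr h))
    obtain ⟨a', b', hab', hsub', hK'⟩ := exists_Icc_of_isCompact isOpen_Ioo ordConnected_Ioo
      (nonempty_Ioo.2 hab) (hφc.isCompact.union hψc.isCompact) hK
    have hθ0 : ∀ x ∉ Ioo a' b', θ x = 0 := fun x hx => by
      simp only [hθ]
      rw [image_eq_zero_of_notMem_tsupport fun h => hx (hK' (Or.inl h)),
        image_eq_zero_of_notMem_tsupport fun h => hx (hK' (Or.inr h)), mul_zero, sub_zero]
    have hφi := hφ.continuous.integrable_of_hasCompactSupport hφc (μ := volume)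
    have hψi := hψ.continuous.integrable_of_hasCompactSupport hψc (μ := volume)
    have hθI : ∫ x in a'..b', θ x = 0 := by
      rw [← setIntegral_eq_intervalIntegral MeasurableSet.univ hab'.le (subset_univ _) hθ0,
        setIntegral_univ]
      simp only [hθ]
      rw [integral_sub hφi (hψi.const_mul m), integral_const_mul, hψI, ← hm, mul_one, sub_self]
    set χ : ℝ → ℝ := fun x => ∫ y in a'..x, θ y with hχ
    have hχd : ∀ x, HasDerivAt χ (θ x) x := fun x =>
      (hθs.continuous.integral_hasStrictDerivAt a' x).hasDerivAt
    have hχd' : deriv χ = θ := funext fun x => (hχd x).deriv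
    have hχs : ContDiff ℝ ∞ χ := by
      rw [contDiff_infty_iff_deriv, hχd']
      exact ⟨fun x => (hχd x).differentiableAt, hθs⟩
    have hχ0 : ∀ x ∉ Icc a' b', χ x = 0 := fun x hx => by
      rcases lt_or_ge x a' with hxa | hxa
      · simp only [hχ]
        rw [intervalIntegral.integral_zero_ae]
        refine Eventually.of_forall fun y hy => hθ0 y fun h => ?_
        rw [uIoc_of_ge hxa.le] at hy
        exact absurd hy.2 (not_le.2 h.1)
      · have hxb : b' < x := not_le.1 fun h => hx ⟨hxa, h⟩
        simp only [hχ]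
        rw [← intervalIntegral.integral_add_adjacent_intervals
          (hθs.continuous.intervalIntegrable a' b') (hθs.continuous.intervalIntegrable b' x),
          hθI, zero_add]
        rw [intervalIntegral.integral_zero_ae]
        refine Eventually.of_forall fun y hy => hθ0 y fun h => ?_
        rw [uIoc_of_le hxb.le] at hy
        exact absurd hy.1 (not_lt.2 h.2.le)
    have hχc : HasCompactSupport χ := HasCompactSupport.intro isCompact_Icc hχ0
    have hχt : tsupport χ ⊆ s := by
      have : tsupport χ ⊆ Icc a' b' := closure_minimal (fun x hx => by
        by_contra hn; exact hx (hχ0 x hn)) isClosed_Icc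
      exact this.trans (hsub'.trans (Ioo_subset_Icc_self.trans hsub))
    have h0 := h χ hχs hχc hχt
    rw [hχd'] at h0
    have hφint := hint φ hφ.continuous hφc hφs
    have hψint := hint ψ hψ.continuous hψc hψs
    have h1 : ∫ x in s, f x * φ x = m * c := by
      have : (fun x => f x * θ x) = fun x => f x * φ x - m * (f x * ψ x) := by
        ext x; simp only [hθ]; ring
      rw [this, integral_sub hφint (hψint.const_mul m), integral_const_mul] at h0
      linarith
    have h2 : ∫ x in s, φ x = m :=
      setIntegral_eq_integral_of_forall_compl_eq_zero fun x hx =>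
        image_eq_zero_of_notMem_tsupport fun h => hx (hφs h)
    rw [← setIntegral_eq_integral_of_forall_compl_eq_zero (s := s) fun x hx => by
      rw [image_eq_zero_of_notMem_tsupport fun h => hx (hφs h), zero_smul]]
    have : (fun x => φ x • (f x - c)) = fun x => f x * φ x - c * φ x := by
      ext x; simp only [smul_eq_mul]; ring
    rw [this, integral_sub hφint (hφi.restrict.const_mul c), integral_const_mul, h1, h2]
    ring
  rw [EventuallyEq, ae_restrict_iff' hs.measurableSet]
  filter_upwards [key] with x hx hxs
  exact sub_eq_zero.1 (hx hxs)

/-! ### Sobolev functions on an edge -/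

theorem _root_.HasWeakDerivOn.ae_eq {s : Set ℝ} (hs : IsOpen s) {f g₁ g₂ : ℝ → ℝ}
    (h₁ : HasWeakDerivOn s f g₁) (h₂ : HasWeakDerivOn s f g₂) : g₁ =ᵐ[volume.restrict s] g₂ := by
  have hint : ∀ g : ℝ → ℝ, LocallyIntegrableOn g s → ∀ φ : ℝ → ℝ, Continuous φ →
      HasCompactSupport φ → tsupport φ ⊆ s →
      Integrable (fun x => g x * φ x) (volume.restrict s) := fun g hg φ hφ hφc hφs => by
    have h1 := (hg.integrableOn_compact_subset hφs hφc).mul_continuousOn hφ.continuousOn hφc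
    have h2 : IntegrableOn (fun x => g x * φ x) s := by
      refine (integrableOn_iff_integrable_of_support_subset ?_).1 h1 |>.integrableOn
      exact (Function.support_mul_subset_right _ _).trans (subset_tsupport _)
    exact h2
  have key : ∀ᵐ x, x ∈ s → g₁ x - g₂ x = 0 := by
    refine hs.ae_eq_zero_of_integral_contDiff_smul_eq_zero (h₁.2.1.sub h₂.2.1)
      fun φ hφ hφc hφs => ?_
    rw [← setIntegral_eq_integral_of_forall_compl_eq_zero (s := s) fun x hx => by
      rw [image_eq_zero_of_notMem_tsupport fun h => hx (hφs h), zero_smul]]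
    have : (fun x => φ x • (g₁ x - g₂ x)) = fun x => g₁ x * φ x - g₂ x * φ x := by
      ext x; simp only [smul_eq_mul]; ring
    rw [this, integral_sub (hint _ h₁.2.1 φ hφ.continuous hφc hφs)
      (hint _ h₂.2.1 φ hφ.continuous hφc hφs)]
    have e1 := h₁.2.2 φ hφ hφc hφs
    have e2 := h₂.2.2 φ hφ hφc hφs
    linarith
  rw [EventuallyEq, ae_restrict_iff' hs.measurableSet]
  filter_upwards [key] with x hx hxs
  exact sub_eq_zero.1 (hx hxs)

/-- `weakDerivOn` is an arbitrary choice; uniqueness of weak derivatives allows any explicit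
representative to replace it under an integral. -/
theorem _root_.HasWeakDerivOn.weakDerivOn_ae_eq {s : Set ℝ} (hs : IsOpen s) {f g : ℝ → ℝ}
    (h : HasWeakDerivOn s f g) : weakDerivOn s f =ᵐ[volume.restrict s] g := by
  have hex : ∃ g, HasWeakDerivOn s f g := ⟨g, h⟩
  rw [weakDerivOn, dif_pos hex]
  exact HasWeakDerivOn.ae_eq hs hex.choose_spec h

theorem _root_.MemH1On.hasWeakDerivOn {s : Set ℝ} {f : ℝ → ℝ} (h : MemH1On s f) :
    HasWeakDerivOn s f (weakDerivOn s f) := by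
  obtain ⟨-, g, hg, -⟩ := h
  have hex : ∃ g, HasWeakDerivOn s f g := ⟨g, hg⟩
  rw [weakDerivOn, dif_pos hex]
  exact hex.choose_spec

theorem _root_.MemH1On.memLp_weakDerivOn {s : Set ℝ} (hs : IsOpen s) {f : ℝ → ℝ}
    (h : MemH1On s f) : MemLp (weakDerivOn s f) 2 (volume.restrict s) := by
  obtain ⟨-, g, hg, hg2⟩ := h
  exact hg2.ae_eq (HasWeakDerivOn.weakDerivOn_ae_eq hs hg).symm

/-- `s` and `t` are the open and the closed interval identified with an edge. -/
def IsEdge (s t : Set ℝ) : Prop :=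
  (∃ T, 0 < T ∧ s = Ioo 0 T ∧ t = Icc 0 T) ∨ (s = Ioi 0 ∧ t = Ici 0)

namespace IsEdge

variable {s t : Set ℝ}

theorem isOpen (h : IsEdge s t) : IsOpen s := by
  rcases h with ⟨T, -, rfl, rfl⟩ | ⟨rfl, rfl⟩
  exacts [isOpen_Ioo, isOpen_Ioi]

theorem ordConnected (h : IsEdge s t) : s.OrdConnected := by
  rcases h with ⟨T, -, rfl, rfl⟩ | ⟨rfl, rfl⟩
  exacts [ordConnected_Ioo, ordConnected_Ioi]

theorem ordConnected_closed (h : IsEdge s t) : t.OrdConnected := by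
  rcases h with ⟨T, -, rfl, rfl⟩ | ⟨rfl, rfl⟩
  exacts [ordConnected_Icc, ordConnected_Ici]

theorem nonempty (h : IsEdge s t) : s.Nonempty := by
  rcases h with ⟨T, hT, rfl, rfl⟩ | ⟨rfl, rfl⟩
  exacts [nonempty_Ioo.2 hT, nonempty_Ioi]

theorem subset (h : IsEdge s t) : s ⊆ t := by
  rcases h with ⟨T, -, rfl, rfl⟩ | ⟨rfl, rfl⟩
  exacts [Ioo_subset_Icc_self, Ioi_subset_Ici_self]

theorem subset_closure (h : IsEdge s t) : t ⊆ closure s := by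
  rcases h with ⟨T, hT, rfl, rfl⟩ | ⟨rfl, rfl⟩
  · rw [closure_Ioo hT.ne]
  · rw [closure_Ioi]

theorem isClosed (h : IsEdge s t) : IsClosed t := by
  rcases h with ⟨T, -, rfl, rfl⟩ | ⟨rfl, rfl⟩
  exacts [isClosed_Icc, isClosed_Ici]

theorem zero_mem (h : IsEdge s t) : (0:ℝ) ∈ t := by
  rcases h with ⟨T, hT, rfl, rfl⟩ | ⟨rfl, rfl⟩
  exacts [left_mem_Icc.2 hT.le, self_mem_Ici]

theorem nonneg (h : IsEdge s t) {x : ℝ} (hx : x ∈ t) : 0 ≤ x := by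
  rcases h with ⟨T, hT, rfl, rfl⟩ | ⟨rfl, rfl⟩
  exacts [hx.1, hx]

theorem ae_restrict (h : IsEdge s t) : volume.restrict s = volume.restrict t := by
  rcases h with ⟨T, -, rfl, rfl⟩ | ⟨rfl, rfl⟩
  exacts [Measure.restrict_congr_set Ioo_ae_eq_Icc, Measure.restrict_congr_set Ioi_ae_eq_Ici]

theorem intervalIntegrable (h : IsEdge s t) {g : ℝ → ℝ} (hg : MemLp g 2 (volume.restrict s))
    {a b : ℝ} (ha : a ∈ t) (hb : b ∈ t) (hab : a ≤ b) : IntervalIntegrable g volume a b := by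
  rw [h.ae_restrict] at hg
  rw [intervalIntegrable_iff_integrableOn_Icc_of_le hab]
  have hsub : Icc a b ⊆ t := h.ordConnected_closed.out ha hb
  exact (hg.mono_measure (Measure.restrict_mono hsub le_rfl)).integrable one_le_two

theorem continuousOn_of_isPrimOn (h : IsEdge s t) {F f : ℝ → ℝ} (hF : IsPrimOn t F f) :
    ContinuousOn F t := by
  have hI : ∀ T, 0 ≤ T → Icc 0 T ⊆ t → ContinuousOn F (Icc 0 T) := fun T hT hsub => by
    obtain ⟨G, hG, hFG, -⟩ := (hF.mono hsub).absolutelyContinuous hT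
    exact (uIcc_of_le hT ▸ hG.continuousOn).congr hFG
  rcases h with ⟨T, hT, rfl, rfl⟩ | ⟨rfl, rfl⟩
  · exact hI T hT.le subset_rfl
  · intro x hx
    have hx0 : (0:ℝ) ≤ x := hx
    refine (hI (x + 1) (by linarith) Icc_subset_Ici_self x ⟨hx, by linarith⟩).mono_of_mem_nhdsWithin
      ?_
    rw [← Ici_inter_Iic]
    exact inter_mem self_mem_nhdsWithin (mem_nhdsWithin_of_mem_nhds (Iic_mem_nhds (lt_add_one x)))

theorem isPrimOn_primitive (h : IsEdge s t) {g : ℝ → ℝ} (hg : MemLp g 2 (volume.restrict s)) :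
    IsPrimOn t (fun x => ∫ y in 0..x, g y) g := fun _ ha _ hb hab =>
  ⟨h.intervalIntegrable hg ha hb hab, (intervalIntegral.integral_add_adjacent_intervals
    (h.intervalIntegrable hg h.zero_mem ha (h.nonneg ha))
    (h.intervalIntegrable hg ha hb hab)).symm⟩

theorem hasWeakDerivOn (h : IsEdge s t) {F f : ℝ → ℝ} (hF : IsPrimOn t F f)
    (hf : MemLp f 2 (volume.restrict s)) : HasWeakDerivOn s F f :=
  (hF.mono h.subset).hasWeakDerivOn h.isOpen h.ordConnected h.nonempty
    ((h.continuousOn_of_isPrimOn hF).mono h.subset)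
    (locallyIntegrableOn_of_locallyIntegrable_restrict (hf.locallyIntegrable one_le_two))

theorem memH1On (h : IsEdge s t) {F f : ℝ → ℝ} (hF : IsPrimOn t F f)
    (hF2 : MemLp F 2 (volume.restrict s)) (hf : MemLp f 2 (volume.restrict s)) : MemH1On s F :=
  ⟨hF2, f, h.hasWeakDerivOn hF hf, hf⟩

theorem weakDerivOn_ae_eq (h : IsEdge s t) {F f : ℝ → ℝ} (hF : IsPrimOn t F f)
    (hf : MemLp f 2 (volume.restrict s)) : weakDerivOn s F =ᵐ[volume.restrict s] f :=
  (h.hasWeakDerivOn hF hf).weakDerivOn_ae_eq h.isOpen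

/-- Two functions with the same weak derivative differ by a constant. -/
theorem exists_ae_eq_add_const (h : IsEdge s t) {f F g : ℝ → ℝ} (hf : HasWeakDerivOn s f g)
    (hF : HasWeakDerivOn s F g) : ∃ c : ℝ, f =ᵐ[volume.restrict s] fun x => F x + c := by
  obtain ⟨c, hc⟩ := ae_eq_const_of_forall_integral_deriv_eq_zero h.isOpen h.ordConnected
    h.nonempty (hf.1.sub hF.1) fun φ hφ hφc hφs => by
      have hφ1 : ContDiff ℝ 1 φ := hφ.of_le (by simp)
      have hd := hφ1.continuous_deriv le_rfl
      have hint : ∀ k : ℝ → ℝ, LocallyIntegrableOn k s →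
          Integrable (fun x => k x * deriv φ x) (volume.restrict s) := fun k hk => by
        have h1 := (hk.integrableOn_compact_subset hφs hφc).mul_continuousOn hd.continuousOn hφc
        have h2 : IntegrableOn (fun x => k x * deriv φ x) s := by
          refine (integrableOn_iff_integrable_of_support_subset ?_).1 h1 |>.integrableOn
          exact (Function.support_mul_subset_right _ _).trans support_deriv_subset
        exact h2
      simp only [Pi.sub_apply, sub_mul]
      rw [integral_sub (hint _ hf.1) (hint _ hF.1), hf.2.2 φ hφ hφc hφs, hF.2.2 φ hφ hφc hφs,
        sub_self]
  refine ⟨c, hc.mono fun x hx => ?_⟩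
  simp only [Pi.sub_apply] at hx
  linarith

/-- A continuous `H¹` function is the indefinite integral of its weak derivative. -/
theorem isPrimOn_weakDerivOn (h : IsEdge s t) {f : ℝ → ℝ} (hf : ContinuousOn f t)
    (hH : MemH1On s f) : IsPrimOn t f (weakDerivOn s f) := by
  have hg := hH.memLp_weakDerivOn h.isOpen
  have hP := h.isPrimOn_primitive hg
  obtain ⟨c, hc⟩ := h.exists_ae_eq_add_const hH.hasWeakDerivOn (h.hasWeakDerivOn hP hg)
  have hcont : ContinuousOn (fun x => (∫ y in 0..x, weakDerivOn s f y) + c) t :=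
    (h.continuousOn_of_isPrimOn hP).add continuousOn_const
  -- Continuous functions that agree almost everywhere on an open set agree on it, and then on the
  -- closed edge by density.
  have heq := (Measure.eqOn_open_of_ae_eq hc h.isOpen (hf.mono h.subset)
    (hcont.mono h.subset)).of_subset_closure hf hcont h.subset h.subset_closure
  intro a ha b hb hab
  obtain ⟨h1, h2⟩ := hP a ha b hb hab
  refine ⟨h1, ?_⟩
  have ea := heq ha
  have eb := heq hb
  simp only at ea eb h2
  rw [ea, eb, h2]
  ring

end IsEdge

theorem IsPrimOn.setIntegral_Ioo {T : ℝ} (hT : 0 ≤ T) {F f : ℝ → ℝ}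
    (hF : IsPrimOn (Icc 0 T) F f) : ∫ x in Ioo 0 T, f x = F T - F 0 := by
  rw [← integral_Ioc_eq_integral_Ioo, ← intervalIntegral.integral_of_le hT,
    (hF 0 (left_mem_Icc.2 hT) T (right_mem_Icc.2 hT) hT).2]
  ring

/-- `F` has a limit at infinity because `f` is integrable, and the limit is zero because `F` is
integrable too. -/
theorem IsPrimOn.setIntegral_Ioi {F f : ℝ → ℝ} (hF : IsPrimOn (Ici 0) F f)
    (hf : IntegrableOn f (Ioi 0)) (hFi : IntegrableOn F (Ioi 0)) :
    ∫ x in Ioi 0, f x = -F 0 := by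
  have h1 := intervalIntegral_tendsto_integral_Ioi 0 hf tendsto_id
  have h2 : Tendsto F atTop (𝓝 (F 0 + ∫ x in Ioi 0, f x)) := by
    refine (h1.const_add (F 0)).congr' ?_
    filter_upwards [eventually_ge_atTop 0] with x hx
    exact (hF 0 self_mem_Ici x hx hx).2.symm
  have h3 : IntegrableAtFilter F atTop volume := ⟨Ioi 0, Ioi_mem_atTop 0, hFi⟩
  have h4 := h3.eq_zero_of_tendsto (fun u hu => by
    obtain ⟨a, ha⟩ := mem_atTop_sets.1 hu
    exact measure_mono_top (fun x hx => ha x hx) Real.volume_Ici) h2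
  linarith

/-! ### Solutions in `H¹` of an edge -/

namespace IsEdge

variable {s t : Set ℝ}

theorem exists_continuous_eqOn (h : IsEdge s t) {f : ℝ → ℝ} (hf : ContinuousOn f t) :
    ∃ g : ℝ → ℝ, Continuous g ∧ EqOn g f t := by
  rcases h with ⟨T, hT, rfl, rfl⟩ | ⟨rfl, rfl⟩
  · refine ⟨fun x => f (max 0 (min x T)), ?_, fun x hx => ?_⟩
    · exact hf.comp_continuous (by fun_prop) fun x =>
        ⟨le_max_left _ _, max_le hT.le (min_le_right _ _)⟩
    · simp only [min_eq_left hx.2, max_eq_right hx.1]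
  · refine ⟨fun x => f (max 0 x), ?_, fun x hx => ?_⟩
    · exact hf.comp_continuous (by fun_prop) fun x => mem_Ici.2 (le_max_left _ _)
    · simp only [max_eq_right (show (0:ℝ) ≤ x from hx)]

theorem isPrimOn_of_continuousOn (h : IsEdge s t) {f : ℝ → ℝ} (hf : ContinuousOn f t) :
    IsPrimOn t (fun x => ∫ y in 0..x, f y) f := by
  have hi : ∀ a ∈ t, ∀ b ∈ t, a ≤ b → IntervalIntegrable f volume a b := fun a ha b hb hab =>
    (hf.mono ((uIcc_of_le hab).symm ▸ h.ordConnected_closed.out ha hb)).intervalIntegrable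
  exact fun a ha b hb hab => ⟨hi a ha b hb hab,
    (intervalIntegral.integral_add_adjacent_intervals (hi 0 h.zero_mem a ha (h.nonneg ha))
      (hi a ha b hb hab)).symm⟩

/-- The fundamental theorem of calculus on an edge. -/
theorem hasDerivWithinAt_of_isPrimOn (h : IsEdge s t) {F f : ℝ → ℝ} (hF : IsPrimOn t F f)
    (hf : ContinuousOn f t) {x : ℝ} (hx : x ∈ t) : HasDerivWithinAt F (f x) t x := by
  -- A continuous extension of `f` makes the two-sided fundamental theorem available even at the
  -- endpoints.
  obtain ⟨g, hg, hgf⟩ := h.exists_continuous_eqOn hf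
  have h1 : HasDerivAt (fun x => F 0 + ∫ y in 0..x, g y) (g x) x :=
    (hg.integral_hasStrictDerivAt 0 x).hasDerivAt.const_add _
  have h2 : EqOn F (fun x => F 0 + ∫ y in 0..x, g y) t := fun y hy => by
    rw [(hF 0 h.zero_mem y hy (h.nonneg hy)).2]
    congr 1
    refine intervalIntegral.integral_congr fun z hz => ?_
    rw [uIcc_of_le (h.nonneg hy)] at hz
    exact (hgf (h.ordConnected_closed.out h.zero_mem hy hz)).symm
  rw [← hgf hx]
  exact h1.hasDerivWithinAt.congr h2 (h2 hx)

theorem convex_closed (h : IsEdge s t) : Convex ℝ t := h.ordConnected_closed.convex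

end IsEdge

theorem IsPrimOn.congr_ae {s t : Set ℝ} (h : IsEdge s t) {F f g : ℝ → ℝ} (hF : IsPrimOn t F f)
    (hfg : f =ᵐ[volume.restrict s] g) : IsPrimOn t F g := by
  rw [h.ae_restrict, EventuallyEq, ae_restrict_iff' h.isClosed.measurableSet] at hfg
  intro a ha b hb hab
  have hsub : Icc a b ⊆ t := h.ordConnected_closed.out ha hb
  have he : ∀ᵐ x, x ∈ uIoc a b → f x = g x := hfg.mono fun x hx hxm =>
    hx (hsub (Ioc_subset_Icc_self (uIoc_of_le hab ▸ hxm)))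
  obtain ⟨h1, h2⟩ := hF a ha b hb hab
  refine ⟨h1.congr_ae ?_, h2.trans ?_⟩
  · rw [EventuallyEq, ae_restrict_iff' measurableSet_uIoc]; exact he
  · rw [intervalIntegral.integral_congr_ae he]

theorem IsSol.isPrimOn (hp : 2 < p) {t : Set ℝ} (ht : t.OrdConnected) {u v : ℝ → ℝ}
    (h : IsSol p t u v) : IsPrimOn t u v ∧ IsPrimOn t v fun x => force p (u x) :=
  ⟨isPrimOn_of_hasDerivWithinAt ht (fun x hx => (h x hx).1) h.continuousOn_deriv,
    isPrimOn_of_hasDerivWithinAt ht (fun x hx => (h x hx).2)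
      ((continuous_force hp).comp_continuousOn h.continuousOn)⟩

theorem abs_force_le (hp : 2 < p) {R u : ℝ} (hu : |u| ≤ R) :
    |force p u| ≤ (1 + R ^ (p - 2)) * |u| := by
  have h1 : |u| ^ (p - 2) ≤ R ^ (p - 2) := Real.rpow_le_rpow (abs_nonneg _) hu (by linarith)
  have h2 : 0 ≤ |u| ^ (p - 2) := by positivity
  have : force p u = (1 - |u| ^ (p - 2)) * u := by unfold force; ring
  rw [this, abs_mul]
  gcongr
  rw [abs_le]
  constructor <;> linarith

/-- Regularity data of a solution of the equation on an edge. -/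
structure IsH1Sol (p : ℝ) (s t : Set ℝ) (u v : ℝ → ℝ) : Prop where
  isEdge : IsEdge s t
  isSol : IsSol p t u v
  memLp : MemLp u 2 (volume.restrict s)
  memLp_deriv : MemLp v 2 (volume.restrict s)

namespace IsH1Sol

variable {s t : Set ℝ} {u v : ℝ → ℝ}

theorem exists_bound (hp : 2 < p) (h : IsH1Sol p s t u v) :
    ∃ R, 0 ≤ R ∧ ∀ x ∈ t, |u x| ≤ R := by
  obtain ⟨R, hR0, hR⟩ := exists_bound_of_energy_le hp (energy p (u 0) (v 0))
  exact ⟨R, hR0, fun x hx =>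
    (h.isSol.abs_le_of_energy_le hp hR h.isEdge.convex_closed h.isEdge.zero_mem le_rfl hx).1⟩

theorem ae_mem (h : IsH1Sol p s t u v) : ∀ᵐ x ∂volume.restrict s, x ∈ t :=
  (ae_restrict_mem h.isEdge.isOpen.measurableSet).mono fun _ hx => h.isEdge.subset hx

theorem memLp_force (hp : 2 < p) (h : IsH1Sol p s t u v) :
    MemLp (fun x => force p (u x)) 2 (volume.restrict s) := by
  obtain ⟨R, hR0, hR⟩ := h.exists_bound hp
  refine (h.memLp.const_mul (1 + R ^ (p - 2))).mono
    ((continuous_force hp).comp_aestronglyMeasurable h.memLp.1) (h.ae_mem.mono fun x hx => ?_)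
  rw [norm_mul, Real.norm_eq_abs, Real.norm_eq_abs, Real.norm_eq_abs]
  exact (abs_force_le hp (hR x hx)).trans (by gcongr; exact le_abs_self _)

theorem integrable_rpow (hp : 2 < p) (h : IsH1Sol p s t u v) :
    IntegrableOn (fun x => |u x| ^ p) s := by
  obtain ⟨R, hR0, hR⟩ := h.exists_bound hp
  refine Integrable.mono' (h.memLp.integrable_sq.const_mul (R ^ (p - 2))) ?_
    (h.ae_mem.mono fun x hx => ?_)
  · exact (continuous_abs.rpow_const fun _ => Or.inr (by linarith)).comp_aestronglyMeasurable
      h.memLp.1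
  · rw [Real.norm_eq_abs, abs_of_nonneg (by positivity), abs_rpow_eq_mul_sq hp]
    have h1 : |u x| ^ (p - 2) ≤ R ^ (p - 2) :=
      Real.rpow_le_rpow (abs_nonneg _) (hR x hx) (by linarith)
    gcongr

theorem weakDerivOn_ae_eq (hp : 2 < p) (h : IsH1Sol p s t u v) :
    weakDerivOn s u =ᵐ[volume.restrict s] v :=
  h.isEdge.weakDerivOn_ae_eq (h.isSol.isPrimOn hp h.isEdge.ordConnected_closed).1 h.memLp_deriv

theorem memH1On (hp : 2 < p) (h : IsH1Sol p s t u v) : MemH1On s u :=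
  h.isEdge.memH1On (h.isSol.isPrimOn hp h.isEdge.ordConnected_closed).1 h.memLp h.memLp_deriv

theorem isPrimOn_mul (hp : 2 < p) (h : IsH1Sol p s t u v) {η η' : ℝ → ℝ} (hη : IsPrimOn t η η') :
    IsPrimOn t (fun x => v x * η x) (fun x => force p (u x) * η x + v x * η' x) :=
  (h.isSol.isPrimOn hp h.isEdge.ordConnected_closed).2.mul h.isEdge.ordConnected_closed hη

theorem integrable_mul (hp : 2 < p) (h : IsH1Sol p s t u v) {η η' : ℝ → ℝ}
    (hη : MemLp η 2 (volume.restrict s)) (hη' : MemLp η' 2 (volume.restrict s)) :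
    IntegrableOn (fun x => force p (u x) * η x + v x * η' x) s :=
  ((h.memLp_force hp).integrable_mul hη).add (h.memLp_deriv.integrable_mul hη')

end IsH1Sol

theorem IsH1Sol.setIntegral_Ioo (hp : 2 < p) {T : ℝ} {u v η η' : ℝ → ℝ} (hT : 0 < T)
    (h : IsH1Sol p (Ioo 0 T) (Icc 0 T) u v) (hη : IsPrimOn (Icc 0 T) η η') :
    ∫ x in Ioo 0 T, (force p (u x) * η x + v x * η' x) = v T * η T - v 0 * η 0 :=
  (h.isPrimOn_mul hp hη).setIntegral_Ioo hT.le

theorem IsH1Sol.setIntegral_Ioi (hp : 2 < p) {u v η η' : ℝ → ℝ}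
    (h : IsH1Sol p (Ioi 0) (Ici 0) u v) (hη : IsPrimOn (Ici 0) η η')
    (h2 : MemLp η 2 (volume.restrict (Ioi 0))) (h2' : MemLp η' 2 (volume.restrict (Ioi 0))) :
    ∫ x in Ioi 0, (force p (u x) * η x + v x * η' x) = -(v 0 * η 0) :=
  (h.isPrimOn_mul hp hη).setIntegral_Ioi (h.integrable_mul hp h2 h2')
    (h.memLp_deriv.integrable_mul h2)

/-- The energy is constant and integrable on a set of infinite measure. -/
theorem IsH1Sol.energy_eq_zero (hp : 2 < p) {u v : ℝ → ℝ} (h : IsH1Sol p (Ioi 0) (Ici 0) u v) :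
    energy p (u 0) (v 0) = 0 := by
  have h1 : IntegrableOn (fun x => energy p (u x) (v x)) (Ioi 0) :=
    ((h.memLp_deriv.integrable_sq.div_const 2).sub (h.memLp.integrable_sq.div_const 2)).add
      ((h.integrable_rpow hp).div_const p)
  have h2 : Tendsto (fun x => energy p (u x) (v x)) atTop (𝓝 (energy p (u 0) (v 0))) := by
    refine tendsto_const_nhds.congr' ?_
    filter_upwards [eventually_ge_atTop 0] with x hx
    exact h.isSol.energy_eq_energy hp (convex_Ici 0) self_mem_Ici hx
  have h3 : IntegrableAtFilter (fun x => energy p (u x) (v x)) atTop volume :=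
    ⟨Ioi 0, Ioi_mem_atTop 0, h1⟩
  exact h3.eq_zero_of_tendsto (fun u hu => by
    obtain ⟨a, ha⟩ := mem_atTop_sets.1 hu
    exact measure_mono_top (fun x hx => ha x hx) Real.volume_Ici) h2

/-- Integrate the constant energy over the edge and drop the term `-u²/2`. -/
theorem IsH1Sol.mul_energy_le (hp : 2 < p) {T : ℝ} {u v : ℝ → ℝ} (hT : 0 < T)
    (h : IsH1Sol p (Ioo 0 T) (Icc 0 T) u v) :
    T * energy p (u 0) (v 0) ≤ (∫ x in Ioo 0 T, v x ^ 2) / 2 + (∫ x in Ioo 0 T, |u x| ^ p) / p := by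
  have h1 : ∫ x in Ioo 0 T, energy p (u x) (v x) = T * energy p (u 0) (v 0) := by
    rw [setIntegral_congr_fun measurableSet_Ioo (g := fun _ => energy p (u 0) (v 0)) fun x hx =>
      h.isSol.energy_eq_energy hp (convex_Icc 0 T) (Ioo_subset_Icc_self hx)
        (left_mem_Icc.2 hT.le)]
    simp [hT.le]
  rw [← h1, ← integral_div, ← integral_div,
    ← integral_add (h.memLp_deriv.integrable_sq.div_const 2) ((h.integrable_rpow hp).div_const p)]
  refine integral_mono (((h.memLp_deriv.integrable_sq.div_const 2).sub
    (h.memLp.integrable_sq.div_const 2)).add ((h.integrable_rpow hp).div_const p))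
    ((h.memLp_deriv.integrable_sq.div_const 2).add ((h.integrable_rpow hp).div_const p))
    fun x => ?_
  simp only [energy]
  nlinarith [sq_nonneg (u x)]

/-- On a compact edge, every solution is in `H¹`. -/
theorem IsSol.isH1Sol {T : ℝ} (hT : 0 < T) {u v : ℝ → ℝ} (h : IsSol p (Icc 0 T) u v) :
    IsH1Sol p (Ioo 0 T) (Icc 0 T) u v := by
  have key : ∀ f : ℝ → ℝ, ContinuousOn f (Icc 0 T) → MemLp f 2 (volume.restrict (Ioo 0 T)) :=
    fun f hf => by
      rw [Measure.restrict_congr_set Ioo_ae_eq_Icc]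
      obtain ⟨C, hC⟩ := isCompact_Icc.exists_bound_of_continuousOn hf
      exact MemLp.of_bound (hf.aestronglyMeasurable measurableSet_Icc) C
        ((ae_restrict_mem measurableSet_Icc).mono hC)
  exact ⟨Or.inl ⟨T, hT, rfl, rfl⟩, h, key _ h.continuousOn, key _ h.continuousOn_deriv⟩

/-! ### Bound states are classical solutions -/

open SingleKnotGraph

variable {G : SingleKnotGraph}

theorem isEdge (G : SingleKnotGraph) : ∀ e, IsEdge (G.openEdge e) (G.closedEdge e)
  | Sum.inl _ => Or.inr ⟨rfl, rfl⟩
  | Sum.inr (Sum.inl i) => Or.inl ⟨_, G.pendantLength_pos i, rfl, rfl⟩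
  | Sum.inr (Sum.inr j) => Or.inl ⟨_, G.loopLength_pos j, rfl, rfl⟩

/-- The vertex conditions at `0` and at the ends of pendants and loops, for a family `u` with
derivatives `v`. -/
structure VertexConditions (G : SingleKnotGraph) (u v : G.Edge → ℝ → ℝ) : Prop where
  vertex : ∀ e e', u e 0 = u e' 0
  loop_end : ∀ j, u (G.loop j) (G.loopLength j) = u (G.loop j) 0
  neumann : ∀ i, v (G.pendant i) (G.pendantLength i) = 0
  kirchhoff : ∑ i, v (G.halfLine i) 0 + (∑ i, v (G.pendant i) 0 +
    ∑ j, (v (G.loop j) 0 - v (G.loop j) (G.loopLength j))) = 0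

/-- A family of edgewise classical `H¹` solutions satisfying the vertex conditions. -/
structure IsClassical (G : SingleKnotGraph) (p : ℝ) (u v : G.Edge → ℝ → ℝ) : Prop where
  isH1Sol : ∀ e, IsH1Sol p (G.openEdge e) (G.closedEdge e) (u e) (v e)
  conditions : VertexConditions G u v

/-- An `H¹` function on the graph together with edgewise derivatives. -/
structure IsTest (G : SingleKnotGraph) (η η' : G.Edge → ℝ → ℝ) : Prop where
  isPrimOn : ∀ e, IsPrimOn (G.closedEdge e) (η e) (η' e)
  memLp : ∀ e, MemLp (η e) 2 (volume.restrict (G.openEdge e))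
  memLp_deriv : ∀ e, MemLp (η' e) 2 (volume.restrict (G.openEdge e))
  vertex : ∀ e e', η e 0 = η e' 0
  loop_end : ∀ j, η (G.loop j) (G.loopLength j) = η (G.loop j) 0

theorem IsTest.memH1 {η η' : G.Edge → ℝ → ℝ} (h : IsTest G η η') : G.MemH1 η :=
  ⟨fun e => (isEdge G e).continuousOn_of_isPrimOn (h.isPrimOn e), h.vertex, h.loop_end,
    fun e => (isEdge G e).memH1On (h.isPrimOn e) (h.memLp e) (h.memLp_deriv e)⟩

theorem _root_.SingleKnotGraph.MemH1.isTest {η : G.Edge → ℝ → ℝ} (h : G.MemH1 η) :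
    IsTest G η (G.weakDeriv η) :=
  ⟨fun e => (isEdge G e).isPrimOn_weakDerivOn (h.continuousOn e) (h.memH1On e),
    fun e => (h.memH1On e).1, fun e => (h.memH1On e).memLp_weakDerivOn (isEdge G e).isOpen,
    h.vertex, h.loop_end⟩

/-- The weak formulation with prescribed representatives of the derivatives. -/
theorem _root_.SingleKnotGraph.IsBoundState.sum_integral_eq_zero {u : G.Edge → ℝ → ℝ}
    (h : G.IsBoundState p u) {η η' : G.Edge → ℝ → ℝ} (hη : IsTest G η η') :
    ∑ e, ∫ x in G.openEdge e, (G.weakDeriv u e x * η' e x + force p (u e x) * η e x) = 0 := by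
  rw [← h.weak η hη.memH1]
  refine Finset.sum_congr rfl fun e _ => integral_congr_ae ?_
  filter_upwards [(isEdge G e).weakDerivOn_ae_eq (hη.isPrimOn e) (hη.memLp_deriv e)] with x hx
  simp only [weakDeriv, force]
  rw [hx]
  ring

theorem isPrimOn_zero (t : Set ℝ) : IsPrimOn t 0 0 := fun a _ b _ _ =>
  ⟨intervalIntegrable_const (c := (0:ℝ)), by simp⟩

/-- Extension by zero from one edge stays continuous on the graph only if `ψ` vanishes at the
vertex, which for a loop means at both ends. -/
theorem isTest_update (e : G.Edge) {ψ ψ' : ℝ → ℝ} (hψ : IsPrimOn (G.closedEdge e) ψ ψ')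
    (h2 : MemLp ψ 2 (volume.restrict (G.openEdge e)))
    (h2' : MemLp ψ' 2 (volume.restrict (G.openEdge e))) (h0 : ψ 0 = 0)
    (hl : ∀ j, e = G.loop j → ψ (G.loopLength j) = 0) :
    IsTest G (Function.update 0 e ψ) (Function.update 0 e ψ') := by
  have hz : ∀ e', Function.update (0 : G.Edge → ℝ → ℝ) e ψ e' 0 = 0 := fun e' => by
    rcases eq_or_ne e' e with rfl | he
    · simpa using h0
    · simp [he]
  refine ⟨fun e' => ?_, fun e' => ?_, fun e' => ?_, fun e' e'' => by rw [hz, hz], fun j => ?_⟩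
  · rcases eq_or_ne e' e with rfl | he
    · simpa using hψ
    · simpa [he] using isPrimOn_zero _
  · rcases eq_or_ne e' e with rfl | he
    · simpa using h2
    · simp [he]
  · rcases eq_or_ne e' e with rfl | he
    · simpa using h2'
    · simp [he]
  · rw [hz]
    rcases eq_or_ne (G.loop j) e with he | he
    · rw [← he, Function.update_self]; exact hl j he.symm
    · simp [he]

theorem _root_.SingleKnotGraph.IsBoundState.integral_edge_eq_zero {u : G.Edge → ℝ → ℝ}
    (h : G.IsBoundState p u) (e : G.Edge) {ψ ψ' : ℝ → ℝ} (hψ : IsPrimOn (G.closedEdge e) ψ ψ')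
    (h2 : MemLp ψ 2 (volume.restrict (G.openEdge e)))
    (h2' : MemLp ψ' 2 (volume.restrict (G.openEdge e))) (h0 : ψ 0 = 0)
    (hl : ∀ j, e = G.loop j → ψ (G.loopLength j) = 0) :
    ∫ x in G.openEdge e, (G.weakDeriv u e x * ψ' x + force p (u e x) * ψ x) = 0 := by
  have := h.sum_integral_eq_zero (isTest_update e hψ h2 h2' h0 hl)
  rw [Finset.sum_eq_single e (fun e' _ he => by simp [he]) (by simp)] at this
  simpa using this

theorem notMem_openEdge (e : G.Edge) : (0:ℝ) ∉ G.openEdge e := by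
  rcases e with i | i | i <;> simp [openEdge]

/-- On each edge, a bound state is a classical solution. -/
theorem _root_.SingleKnotGraph.IsBoundState.exists_isH1Sol (hp : 2 < p) {u : G.Edge → ℝ → ℝ}
    (h : G.IsBoundState p u) (e : G.Edge) :
    ∃ v, IsH1Sol p (G.openEdge e) (G.closedEdge e) (u e) v ∧
      G.weakDeriv u e =ᵐ[volume.restrict (G.openEdge e)] v := by
  have hE := isEdge G e
  have hT := h.memH1.isTest
  set s := G.openEdge e with hs
  set t := G.closedEdge e with ht
  set g := G.weakDeriv u e with hg
  have hcf : ContinuousOn (fun x => force p (u e x)) t :=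
    (continuous_force hp).comp_continuousOn (h.memH1.continuousOn e)
  have hgl : LocallyIntegrableOn g s :=
    locallyIntegrableOn_of_locallyIntegrable_restrict
      ((hT.memLp_deriv e).locallyIntegrable one_le_two)
  have hfl : LocallyIntegrableOn (fun x => force p (u e x)) s :=
    (hcf.mono hE.subset).locallyIntegrableOn hE.isOpen.measurableSet
  -- Testing with bumps inside the edge says that `u'` has weak derivative `force p u`. By du
  -- Bois-Reymond `u'` then has the continuous representative `v` below, and the fundamental theorem
  -- applied twice gives a classical solution.
  have hgw : HasWeakDerivOn s g fun x => force p (u e x) := by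
    refine ⟨hgl, hfl, fun φ hφ hφc hφs => ?_⟩
    have hφ1 : ContDiff ℝ 1 φ := hφ.of_le (by simp)
    have hd := hφ1.continuous_deriv le_rfl
    have hφ0 : ∀ x ∉ s, φ x = 0 := fun x hx =>
      image_eq_zero_of_notMem_tsupport fun h => hx (hφs h)
    have hint : ∀ k l : ℝ → ℝ, LocallyIntegrableOn k s → Continuous l →
        Function.support l ⊆ tsupport φ →
        Integrable (fun x => k x * l x) (volume.restrict s) := fun k l hk hl hsup => by
      have h1 := (hk.integrableOn_compact_subset hφs hφc).mul_continuousOn hl.continuousOn hφc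
      have h2 : IntegrableOn (fun x => k x * l x) s := by
        refine (integrableOn_iff_integrable_of_support_subset ?_).1 h1 |>.integrableOn
        exact (Function.support_mul_subset_right _ _).trans hsup
      exact h2
    have h0 := h.integral_edge_eq_zero e (ψ := φ) (ψ' := deriv φ)
      (isPrimOn_of_hasDerivWithinAt hE.ordConnected_closed
        (fun x _ => ((hφ1.differentiable one_ne_zero) x).hasDerivAt.hasDerivWithinAt)
        hd.continuousOn)
      ((hφ.continuous.memLp_of_hasCompactSupport hφc).restrict s)
      ((hd.memLp_of_hasCompactSupport hφc.deriv).restrict s)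
      (hφ0 0 (notMem_openEdge e)) (fun j hj => hφ0 _ (by rw [hs, hj]; simp [openEdge]))
    rw [integral_add (hint _ _ hgl hd support_deriv_subset)
      (hint _ _ hfl hφ.continuous (subset_tsupport φ))] at h0
    linarith
  have hP := hE.isPrimOn_of_continuousOn hcf
  obtain ⟨c, hc⟩ := hE.exists_ae_eq_add_const hgw
    ((hP.mono hE.subset).hasWeakDerivOn hE.isOpen hE.ordConnected hE.nonempty
      ((hE.continuousOn_of_isPrimOn hP).mono hE.subset) hfl)
  set v : ℝ → ℝ := fun x => (∫ y in 0..x, force p (u e y)) + c with hv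
  have hPv : IsPrimOn t v fun x => force p (u e x) := fun a ha b hb hab => by
    obtain ⟨h1, h2⟩ := hP a ha b hb hab
    refine ⟨h1, ?_⟩
    simp only [hv]
    beta_reduce at h2
    rw [h2]; ring
  have hcv : ContinuousOn v t := hE.continuousOn_of_isPrimOn hPv
  refine ⟨v, ⟨hE, fun x hx => ⟨?_, ?_⟩, hT.memLp e, (hT.memLp_deriv e).ae_eq hc⟩, hc⟩
  · exact hE.hasDerivWithinAt_of_isPrimOn ((hT.isPrimOn e).congr_ae hE hc) hcv hx
  · exact hE.hasDerivWithinAt_of_isPrimOn hPv hcf hx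

/-- The boundary terms of an integration by parts over all edges. -/
theorem sum_integral_eq_boundary (hp : 2 < p) {u v : G.Edge → ℝ → ℝ}
    (h : ∀ e, IsH1Sol p (G.openEdge e) (G.closedEdge e) (u e) (v e)) {η η' : G.Edge → ℝ → ℝ}
    (hη : IsTest G η η') :
    ∑ e, ∫ x in G.openEdge e, (v e x * η' e x + force p (u e x) * η e x) =
      ∑ i, -(v (G.halfLine i) 0 * η (G.halfLine i) 0) +
      (∑ i, (v (G.pendant i) (G.pendantLength i) * η (G.pendant i) (G.pendantLength i) -
        v (G.pendant i) 0 * η (G.pendant i) 0) +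
      ∑ j, (v (G.loop j) (G.loopLength j) - v (G.loop j) 0) * η (G.loop j) 0) := by
  simp only [add_comm (v _ _ * η' _ _)]
  rw [Fintype.sum_sum_type, Fintype.sum_sum_type]
  congr 1
  · exact Finset.sum_congr rfl fun i _ => IsH1Sol.setIntegral_Ioi hp (h (G.halfLine i))
      (hη.isPrimOn (G.halfLine i)) (hη.memLp (G.halfLine i)) (hη.memLp_deriv (G.halfLine i))
  congr 1
  · exact Finset.sum_congr rfl fun i _ => IsH1Sol.setIntegral_Ioo hp (G.pendantLength_pos i)
      (h (G.pendant i)) (hη.isPrimOn (G.pendant i))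
  · refine Finset.sum_congr rfl fun j _ => ?_
    rw [sub_mul]
    nth_rw 1 [← hη.loop_end j]
    exact IsH1Sol.setIntegral_Ioo hp (G.loopLength_pos j)
      (h (G.loop j)) (hη.isPrimOn (G.loop j))

/-- The first half-line. -/
def firstEdge (G : SingleKnotGraph) : G.Edge := G.halfLine ⟨0, G.one_le_H⟩

/-- After integration by parts the tips contribute nothing by the Neumann condition, and the vertex
contributes the common test value times minus the Kirchhoff sum. -/
theorem IsClassical.isBoundState (hp : 2 < p) {u v : G.Edge → ℝ → ℝ} (h : IsClassical G p u v)
    (hne : ∃ e, ∃ x ∈ G.closedEdge e, u e x ≠ 0) : G.IsBoundState p u := by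
  refine ⟨⟨fun e => (h.isH1Sol e).isSol.continuousOn, h.conditions.vertex, h.conditions.loop_end,
    fun e => (h.isH1Sol e).memH1On hp⟩, hne, fun η hη => ?_⟩
  have hT := hη.isTest
  have key : G.integral (fun e x => G.weakDeriv u e x * G.weakDeriv η e x + u e x * η e x
      - |u e x| ^ (p - 2) * u e x * η e x) =
      ∑ e, ∫ x in G.openEdge e, (v e x * G.weakDeriv η e x + force p (u e x) * η e x) := by
    refine Finset.sum_congr rfl fun e _ => integral_congr_ae ?_
    filter_upwards [(h.isH1Sol e).weakDerivOn_ae_eq hp] with x hx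
    simp only [weakDeriv, force]
    rw [hx]
    ring
  rw [key, sum_integral_eq_boundary hp h.isH1Sol hT]
  have h0 : ∀ e, η e 0 = η (firstEdge G) 0 := fun e => hη.vertex _ _
  simp only [h0, h.conditions.neumann, zero_mul, zero_sub]
  set c := η (firstEdge G) 0
  trans -((∑ i, v (G.halfLine i) 0 + (∑ i, v (G.pendant i) 0 +
    ∑ j, (v (G.loop j) 0 - v (G.loop j) (G.loopLength j)))) * c)
  · rw [add_mul, add_mul, Finset.sum_mul, Finset.sum_mul, Finset.sum_mul, neg_add, neg_add,
      ← Finset.sum_neg_distrib, ← Finset.sum_neg_distrib, ← Finset.sum_neg_distrib]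
    simp only [← neg_mul, neg_sub]
  · rw [h.conditions.kirchhoff, zero_mul, neg_zero]

/-- Bound states are classical solutions. -/
theorem _root_.SingleKnotGraph.IsBoundState.exists_isClassical (hp : 2 < p) {u : G.Edge → ℝ → ℝ}
    (h : G.IsBoundState p u) :
    ∃ v, IsClassical G p u v ∧
      ∀ e, G.weakDeriv u e =ᵐ[volume.restrict (G.openEdge e)] v e := by
  choose v hv hae using h.exists_isH1Sol hp
  have hneu : ∀ i, v (G.pendant i) (G.pendantLength i) = 0 := fun i => by
    have hT := G.pendantLength_pos i
    have hsol : IsH1Sol p (Ioo 0 (G.pendantLength i)) (Icc 0 (G.pendantLength i)) _ _ :=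
      hv (G.pendant i)
    -- The test function `x` vanishes at the vertex but not at the tip, so it isolates the
    -- derivative at the tip.
    have hP : IsPrimOn (Icc 0 (G.pendantLength i)) (fun x : ℝ => x) (fun _ => 1) :=
      isPrimOn_of_hasDerivWithinAt ordConnected_Icc (fun x _ => hasDerivWithinAt_id x _)
        continuousOn_const
    have hm : MemLp (fun x : ℝ => x) 2 (volume.restrict (Ioo 0 (G.pendantLength i))) := by
      refine MemLp.of_bound (by fun_prop) (G.pendantLength i)
        ((ae_restrict_mem measurableSet_Ioo).mono fun x hx => ?_)
      rw [Real.norm_eq_abs, abs_of_pos hx.1]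
      exact hx.2.le
    have hm' : MemLp (fun _ : ℝ => (1:ℝ)) 2 (volume.restrict (Ioo 0 (G.pendantLength i))) :=
      memLp_const 1
    have h1 := h.integral_edge_eq_zero (G.pendant i) hP hm hm' rfl (fun j hj => by simp at hj)
    have h2 := hsol.setIntegral_Ioo hp hT hP
    have h3 : ∫ x in Ioo 0 (G.pendantLength i), (force p (u (G.pendant i) x) * x +
        v (G.pendant i) x * 1) = 0 := by
      refine (integral_congr_ae ?_).trans h1
      filter_upwards [hae (G.pendant i)] with x hx
      rw [hx]; ring
    rw [h3, mul_zero, sub_zero] at h2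
    exact (mul_eq_zero.1 h2.symm).resolve_right hT.ne'
  refine ⟨v, ⟨hv, h.memH1.vertex, h.memH1.loop_end, hneu, ?_⟩, hae⟩
  -- A test function equal to one at the vertex yields the Kirchhoff sum; the exponential keeps it
  -- in `H¹` on the half-lines.
  set η : G.Edge → ℝ → ℝ := Sum.elim (fun _ x => Real.exp (-x)) fun _ _ => 1 with hη
  set η' : G.Edge → ℝ → ℝ := Sum.elim (fun _ x => -Real.exp (-x)) fun _ _ => 0 with hη'
  have hexp : MemLp (fun x => Real.exp (-x)) 2 (volume.restrict (Ioi 0)) :=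
    memLp_two_of_abs_le_exp (by fun_prop) (C := 1) fun x => by simp
  have hconst : ∀ (T c : ℝ), MemLp (fun _ : ℝ => c) 2 (volume.restrict (Ioo 0 T)) :=
    fun T c => memLp_const c
  have hPc : ∀ t : Set ℝ, t.OrdConnected → IsPrimOn t (fun _ => 1) fun _ => 0 := fun t ht =>
    isPrimOn_of_hasDerivWithinAt ht (fun x _ => hasDerivWithinAt_const x _ 1)
      continuousOn_const
  have hη0 : ∀ e, η e 0 = 1 := by rintro (i | i) <;> simp [hη]
  have hT : IsTest G η η' := by
    refine ⟨?_, ?_, ?_, fun e e' => by rw [hη0, hη0], fun j => rfl⟩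
    · rintro (i | i | i)
      · refine isPrimOn_of_hasDerivWithinAt ordConnected_Ici (fun x _ => ?_) ?_
        · exact ((Real.hasDerivAt_exp (-x)).comp x (hasDerivAt_neg x)).hasDerivWithinAt.congr_deriv
            (by simp [hη'])
        · simp only [hη', Sum.elim_inl]; fun_prop
      · exact hPc _ ordConnected_Icc
      · exact hPc _ ordConnected_Icc
    · rintro (i | i | i)
      exacts [hexp, hconst _ _, hconst _ _]
    · rintro (i | i | i)
      exacts [hexp.neg, hconst _ _, hconst _ _]
  have h1 := sum_integral_eq_boundary hp hv hT
  have h2 : ∑ e, ∫ x in G.openEdge e, (v e x * η' e x + force p (u e x) * η e x) = 0 := by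
    rw [← h.sum_integral_eq_zero hT]
    refine Finset.sum_congr rfl fun e _ => integral_congr_ae ?_
    filter_upwards [hae e] with x hx
    rw [hx]
  rw [h2] at h1
  simp only [hη0, hneu, mul_one, zero_mul, zero_sub] at h1
  refine neg_eq_zero.1 (Eq.trans ?_ h1.symm)
  rw [neg_add, neg_add, ← Finset.sum_neg_distrib,
    ← Finset.sum_neg_distrib, ← Finset.sum_neg_distrib]
  simp only [neg_sub]

/-! ### The action and the existence of bound states -/

/-- The `p`-th power of the `Lᵖ` norm. -/
noncomputable def lpPow (G : SingleKnotGraph) (p : ℝ) (u : G.Edge → ℝ → ℝ) : ℝ :=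
  ∑ e, ∫ x in G.openEdge e, |u e x| ^ p

theorem lpPow_nonneg (u : G.Edge → ℝ → ℝ) : 0 ≤ lpPow G p u :=
  Finset.sum_nonneg fun _ _ => integral_nonneg fun _ => by positivity

theorem integral_rpow_le_lpPow (u : G.Edge → ℝ → ℝ) (e : G.Edge) :
    ∫ x in G.openEdge e, |u e x| ^ p ≤ lpPow G p u :=
  Finset.single_le_sum (f := fun e => ∫ x in G.openEdge e, |u e x| ^ p)
    (fun _ _ => integral_nonneg fun _ => by positivity) (Finset.mem_univ e)

/-- The Nehari identity. -/
theorem _root_.SingleKnotGraph.IsBoundState.nehari (hp : 2 < p) {u : G.Edge → ℝ → ℝ}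
    (h : G.IsBoundState p u) :
    ∑ e, ∫ x in G.openEdge e, (G.weakDeriv u e x ^ 2 + u e x ^ 2) = lpPow G p u := by
  obtain ⟨v, hv, -⟩ := h.exists_isClassical hp
  have hT := h.memH1.isTest
  have h0 := h.sum_integral_eq_zero hT
  have key : ∀ e, ∫ x in G.openEdge e,
      (G.weakDeriv u e x * G.weakDeriv u e x + force p (u e x) * u e x) =
      (∫ x in G.openEdge e, (G.weakDeriv u e x ^ 2 + u e x ^ 2)) -
        ∫ x in G.openEdge e, |u e x| ^ p := fun e => by
    have hi : Integrable (fun x => G.weakDeriv u e x ^ 2 + u e x ^ 2)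
        (volume.restrict (G.openEdge e)) :=
      (hT.memLp_deriv e).integrable_sq.add (hT.memLp e).integrable_sq
    rw [← integral_sub hi ((hv.isH1Sol e).integrable_rpow hp)]
    refine integral_congr_ae (Eventually.of_forall fun x => ?_)
    simp only [force, abs_rpow_eq_mul_sq hp]
    ring
  simp only [key] at h0
  rw [Finset.sum_sub_distrib] at h0
  exact sub_eq_zero.1 h0

/-- By the Nehari identity, minimizing the action over bound-states is minimizing `lpPow`. -/
theorem _root_.SingleKnotGraph.IsBoundState.action_eq (hp : 2 < p) {u : G.Edge → ℝ → ℝ}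
    (h : G.IsBoundState p u) : G.action p u = (1 / 2 - 1 / p) * lpPow G p u := by
  have h1 := h.nehari hp
  simp only [action, SingleKnotGraph.integral]
  rw [h1, lpPow]
  ring

theorem _root_.SingleKnotGraph.IsBoundState.integral_sq_le (hp : 2 < p) {u : G.Edge → ℝ → ℝ}
    (h : G.IsBoundState p u) (e : G.Edge) :
    ∫ x in G.openEdge e, G.weakDeriv u e x ^ 2 ≤ lpPow G p u := by
  have hT := h.memH1.isTest
  rw [← h.nehari hp]
  refine le_trans ?_ (Finset.single_le_sum
    (f := fun e => ∫ x in G.openEdge e, (G.weakDeriv u e x ^ 2 + u e x ^ 2))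
    (fun _ _ => integral_nonneg fun _ => by positivity) (Finset.mem_univ e))
  exact integral_mono (hT.memLp_deriv e).integrable_sq
    ((hT.memLp_deriv e).integrable_sq.add (hT.memLp e).integrable_sq)
    fun x => le_add_of_nonneg_right (sq_nonneg _)

/-- The energy on a compact edge is controlled by the `Lᵖ` norm. -/
theorem _root_.SingleKnotGraph.IsBoundState.mul_energy_le (hp : 2 < p) {u v : G.Edge → ℝ → ℝ}
    (h : G.IsBoundState p u) (hv : IsClassical G p u v)
    (hae : ∀ e, G.weakDeriv u e =ᵐ[volume.restrict (G.openEdge e)] v e) {e : G.Edge} {T : ℝ}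
    (hT : 0 < T) (ho : G.openEdge e = Ioo 0 T) (hc : G.closedEdge e = Icc 0 T) :
    T * energy p (u e 0) (v e 0) ≤ lpPow G p u := by
  have h1 := hv.isH1Sol e
  rw [ho, hc] at h1
  have h2 := h1.mul_energy_le hp hT
  have h3 := h.integral_sq_le hp e
  have h4 : ∫ x in G.openEdge e, G.weakDeriv u e x ^ 2 = ∫ x in G.openEdge e, v e x ^ 2 :=
    integral_congr_ae ((hae e).mono fun x hx => by simp only [hx])
  have h5 := integral_rpow_le_lpPow (p := p) u e
  rw [h4, ho] at h3
  rw [ho] at h5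
  have h6 := lpPow_nonneg (p := p) u
  have h7 : (∫ x in Ioo 0 T, |u e x| ^ p) / p ≤ lpPow G p u / 2 := by
    gcongr
  linarith

theorem one_le_solitonHeight (hp : 2 < p) : 1 ≤ solitonHeight p :=
  Real.one_le_rpow (by linarith) (by
    have : 0 < p - 2 := by linarith
    positivity)

theorem exists_isBoundState_of_even (hp : 2 < p) (hG : Even G.H) :
    ∃ u : G.Edge → ℝ → ℝ, G.IsBoundState p u := by
  obtain ⟨s, hs⟩ := exists_soliton_eq hp one_pos (one_le_solitonHeight hp)
  set b := solitonDeriv p s with hb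
  -- The energy is even in the slope, so slopes of alternating sign remain admissible on the
  -- half-lines; an even number of them sums to zero.
  have hen : ∀ n : ℕ, energy p 1 ((-1) ^ n * b) = 0 := fun n => by
    have := energy_soliton hp s
    rw [hs] at this
    rw [← this]
    simp only [energy, mul_pow, ← pow_mul, mul_comm n 2]
    simp [pow_mul, hb]
  choose uh vh hu0 hv0 hsol hu2 hv2 using fun i : Fin G.H => exists_halfLine_isSol hp (hen i)
  set u : G.Edge → ℝ → ℝ := Sum.elim uh fun _ _ => 1 with hu
  set v : G.Edge → ℝ → ℝ := Sum.elim vh fun _ _ => 0 with hv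
  have h0 : ∀ e, u e 0 = 1 := by rintro (i | i) <;> simp [hu, hu0]
  have hc : IsClassical G p u v := by
    refine ⟨?_, ⟨fun e e' => by rw [h0, h0], fun j => rfl, fun i => rfl, ?_⟩⟩
    · rintro (i | i | i)
      · exact ⟨isEdge G (G.halfLine i), hsol i, hu2 i, hv2 i⟩
      · exact (isSol_one _).isH1Sol (G.pendantLength_pos i)
      · exact (isSol_one _).isH1Sol (G.loopLength_pos i)
    · simp only [hv, Sum.elim_inl, Sum.elim_inr, hv0, sub_self, Finset.sum_const_zero, add_zero]
      rw [← Finset.sum_mul, Fin.sum_univ_eq_sum_range (fun i => (-1 : ℝ) ^ i), neg_one_geom_sum,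
        if_pos hG, zero_mul]
  exact ⟨u, hc.isBoundState hp ⟨firstEdge G, 0, (isEdge G _).zero_mem, by rw [h0]; simp⟩⟩

/-- An odd bound state supported on two edges of the same kind and length. -/
theorem exists_isBoundState_of_two_edges (hp : 2 < p) {e₁ e₂ : G.Edge} (hne : e₁ ≠ e₂) {T : ℝ}
    (hT : 0 < T) (he : ∀ e, e = e₁ ∨ e = e₂ → G.openEdge e = Ioo 0 T ∧ G.closedEdge e = Icc 0 T)
    {w w' : ℝ → ℝ} (hw : IsSol p (Icc 0 T) w w') (hw0 : w 0 = 0) (hw0' : w' 0 ≠ 0)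
    (hpen : ∀ i, G.pendant i = e₁ ∨ G.pendant i = e₂ → w' (G.pendantLength i) = 0)
    (hloop : ∀ j, G.loop j = e₁ ∨ G.loop j = e₂ → w (G.loopLength j) = 0)
    (hflux : (Sum.elim (fun _ => w' 0) (Sum.elim (fun _ => w' 0)
      fun j => w' 0 - w' (G.loopLength j)) : G.Edge → ℝ) e₁ =
      (Sum.elim (fun _ => w' 0) (Sum.elim (fun _ => w' 0)
      fun j => w' 0 - w' (G.loopLength j)) : G.Edge → ℝ) e₂) :
    ∃ u : G.Edge → ℝ → ℝ, G.IsBoundState p u := by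
  classical
  set c : G.Edge → ℝ := fun e => if e = e₁ then 1 else if e = e₂ then -1 else 0 with hc
  have hc1 : c e₁ = 1 := by simp [hc]
  have hc2 : c e₂ = -1 := by simp [hc, hne.symm]
  have hc0 : ∀ e, ¬ (e = e₁ ∨ e = e₂) → c e = 0 := fun e h => by
    rw [not_or] at h
    simp [hc, h.1, h.2]
  -- The flux leaving the vertex through a copy of `w`; a loop contributes both ends. The half-line
  -- entry has coefficient zero and only matches the Kirchhoff sum term by term.
  set fl : G.Edge → ℝ := Sum.elim (fun _ => w' 0) (Sum.elim (fun _ => w' 0)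
      fun j => w' 0 - w' (G.loopLength j)) with hfl
  have hsum : ∑ e, c e * fl e = 0 := by
    rw [← Finset.sum_subset (Finset.subset_univ {e₁, e₂}) fun e _ h => by
      rw [hc0 e (by simpa using h), zero_mul], Finset.sum_pair hne, hc1, hc2, hflux]
    ring
  have hcl : IsClassical G p (fun e x => c e * w x) (fun e x => c e * w' x) := by
    refine ⟨fun e => ?_, ⟨fun e e' => by simp [hw0], fun j => ?_, fun i => ?_, ?_⟩⟩
    · by_cases h : e = e₁ ∨ e = e₂
      · obtain ⟨h1, h2⟩ := he e h
        rw [h1, h2]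
        refine IsSol.isH1Sol hT ?_
        rcases h with rfl | rfl
        · simpa only [hc1, one_mul] using hw
        · simpa only [hc2, neg_mul, one_mul] using hw.neg
      · simp only [hc0 e h, zero_mul]
        exact ⟨isEdge G e, isSol_zero _, MemLp.zero', MemLp.zero'⟩
    · by_cases h : G.loop j = e₁ ∨ G.loop j = e₂
      · rw [hloop j h, hw0]
      · rw [hc0 _ h, zero_mul, zero_mul]
    · by_cases h : G.pendant i = e₁ ∨ G.pendant i = e₂
      · rw [hpen i h, mul_zero]
      · rw [hc0 _ h, zero_mul]
    · rw [Fintype.sum_sum_type, Fintype.sum_sum_type] at hsum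
      refine Eq.trans ?_ hsum
      simp only [hfl, Sum.elim_inl, Sum.elim_inr, mul_sub]
  refine ⟨_, hcl.isBoundState hp ⟨e₁, ?_⟩⟩
  by_contra! hcon
  rw [(he e₁ (Or.inl rfl)).2] at hcon
  have h0 : (0:ℝ) ∈ Icc 0 T := left_mem_Icc.2 hT.le
  have hz : ∀ x ∈ Icc 0 T, w x = 0 := fun x hx => by simpa [hc1] using hcon x hx
  have h1 : HasDerivWithinAt w 0 (Icc 0 T) 0 :=
    (hasDerivWithinAt_const (0:ℝ) (Icc 0 T) (0:ℝ)).congr hz (hz 0 h0)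
  exact hw0' ((uniqueDiffOn_Icc hT 0 h0).eq_deriv _ (hw 0 h0).1 h1)

theorem exists_isBoundState (hp : 2 < p)
    (hG : Even G.H ∨
      (∃ i j : Fin G.P, i ≠ j ∧ G.pendantLength i = G.pendantLength j) ∨
      (∃ i j : Fin G.L, i ≠ j ∧ G.loopLength i = G.loopLength j)) :
    ∃ u : G.Edge → ℝ → ℝ, G.IsBoundState p u := by
  rcases hG with hG | ⟨i, j, hij, hl⟩ | ⟨i, j, hij, hl⟩
  · exact exists_isBoundState_of_even hp hG
  · have hT := G.pendantLength_pos i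
    obtain ⟨w, w', hw, h0, hT', hne⟩ := exists_isSol_mixed hp hT
    refine exists_isBoundState_of_two_edges (e₁ := G.pendant i) (e₂ := G.pendant j) hp
      (by simpa using hij) hT ?_ hw h0 hne ?_ ?_ rfl
    · rintro e (rfl | rfl)
      · exact ⟨rfl, rfl⟩
      · rw [hl]; exact ⟨rfl, rfl⟩
    · rintro k (h | h)
      · rw [show k = i by simpa using h, hT']
      · rw [show k = j by simpa using h, ← hl, hT']
    · rintro k (h | h) <;> simp at h
  · have hT := G.loopLength_pos i
    obtain ⟨w, w', hw, h0, hT', hne⟩ := exists_isSol_dirichlet hp hT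
    refine exists_isBoundState_of_two_edges (e₁ := G.loop i) (e₂ := G.loop j) hp
      (by simpa using hij) hT ?_ hw h0 hne ?_ ?_ (by simp [hl])
    · rintro e (rfl | rfl)
      · exact ⟨rfl, rfl⟩
      · rw [hl]; exact ⟨rfl, rfl⟩
    · rintro k (h | h) <;> simp at h
    · rintro k (h | h)
      · rw [show k = i by simpa using h, hT']
      · rw [show k = j by simpa using h, ← hl, hT']

/-! ### Bound states do not become small -/

/-- The flux absorbed by the compact edges in the linear regime, per unit of vertex value. -/
noncomputable def tanhSum (G : SingleKnotGraph) : ℝ :=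
  ∑ i, Real.tanh (G.pendantLength i) + 2 * ∑ j, Real.tanh (G.loopLength j / 2)

theorem tanh_nonneg {x : ℝ} (hx : 0 ≤ x) : 0 ≤ Real.tanh x := by
  rw [Real.tanh_eq_sinh_div_cosh]
  exact div_nonneg (Real.sinh_nonneg_iff.2 hx) (Real.cosh_pos _).le

theorem tanhSum_nonneg (G : SingleKnotGraph) : 0 ≤ tanhSum G :=
  add_nonneg (Finset.sum_nonneg fun i _ => tanh_nonneg (G.pendantLength_pos i).le)
    (mul_nonneg two_pos.le
      (Finset.sum_nonneg fun j _ => tanh_nonneg (half_pos (G.loopLength_pos j)).le))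

/-- A family is small if it is bounded by one on all compact edges. -/
def IsSmall (G : SingleKnotGraph) (u : G.Edge → ℝ → ℝ) : Prop :=
  (∀ i, ∀ x ∈ Icc 0 (G.pendantLength i), |u (G.pendant i) x| ≤ 1) ∧
    ∀ j, ∀ x ∈ Icc 0 (G.loopLength j), |u (G.loop j) x| ≤ 1

theorem IsClassical.energy_halfLine (hp : 2 < p) {u v : G.Edge → ℝ → ℝ}
    (h : IsClassical G p u v) (i : Fin G.H) :
    energy p (u (G.halfLine i) 0) (v (G.halfLine i) 0) = 0 :=
  IsH1Sol.energy_eq_zero hp (h.isH1Sol (G.halfLine i))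

theorem IsClassical.isSol_pendant {u v : G.Edge → ℝ → ℝ} (h : IsClassical G p u v)
    (i : Fin G.P) :
    IsSol p (Icc 0 (G.pendantLength i)) (u (G.pendant i)) (v (G.pendant i)) :=
  (h.isH1Sol (G.pendant i)).isSol

theorem IsClassical.isSol_loop {u v : G.Edge → ℝ → ℝ} (h : IsClassical G p u v)
    (j : Fin G.L) : IsSol p (Icc 0 (G.loopLength j)) (u (G.loop j)) (v (G.loop j)) :=
  (h.isH1Sol (G.loop j)).isSol

/-- A small solution vanishing at the vertex vanishes. -/
theorem IsClassical.eq_zero_of_isSmall (hp : 2 < p) {u v : G.Edge → ℝ → ℝ}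
    (h : IsClassical G p u v) (hs : IsSmall G u) (h0 : ∀ e, u e 0 = 0) :
    ∀ e, ∀ x ∈ G.closedEdge e, u e x = 0 := by
  rintro (i | i | j) x hx
  · have hx0 : (0:ℝ) ≤ x := hx
    have hen := h.energy_halfLine hp i
    rw [h0, energy_zero_left hp] at hen
    have hv : v (G.halfLine i) 0 = 0 := (pow_eq_zero_iff two_ne_zero).1 (by linarith)
    have hsol : IsSol p (Icc 0 x) (u (G.halfLine i)) (v (G.halfLine i)) :=
      IsSol.mono (s := Ici 0) (h.isH1Sol (G.halfLine i)).isSol Icc_subset_Ici_self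
    exact (hsol.eq_of_eq hp (isSol_zero _) (h0 _) hv ⟨hx0, le_rfl⟩).1
  · have := (h.isSol_pendant i).abs_le_of_neumann hp (hs.1 i) (h.conditions.neumann i) x hx
    rw [h0, abs_zero] at this
    exact abs_nonpos_iff.1 this
  · have := (h.isSol_loop j).abs_le_of_loop hp (hs.2 j) (h.conditions.loop_end j) x hx
    rw [h0, abs_zero] at this
    exact abs_nonpos_iff.1 this

/-- The total outgoing derivative on the half-lines of a small solution. -/
theorem IsClassical.abs_sum_halfLine_sub_le (hp : 2 < p) {u v : G.Edge → ℝ → ℝ}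
    (h : IsClassical G p u v) (hs : IsSmall G u) {a : ℝ} (ha : ∀ e, u e 0 = a) :
    |∑ i, v (G.halfLine i) 0 - a * tanhSum G| ≤
      |a| ^ (p - 2) * |a| * (∑ i, G.pendantLength i + ∑ j, G.loopLength j) := by
  have hP : ∀ i, |v (G.pendant i) 0 + a * Real.tanh (G.pendantLength i)| ≤
      |a| ^ (p - 2) * |a| * G.pendantLength i := fun i => by
    simpa only [ha] using (h.isSol_pendant i).abs_deriv_add_tanh_le hp
      (G.pendantLength_pos i).le (hs.1 i) (h.conditions.neumann i)
  have hL : ∀ j, |v (G.loop j) 0 - v (G.loop j) (G.loopLength j) +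
      a * (2 * Real.tanh (G.loopLength j / 2))| ≤ |a| ^ (p - 2) * |a| * G.loopLength j :=
    fun j => by
      simpa only [ha] using (h.isSol_loop j).abs_deriv_sub_deriv_add_tanh_le hp
        (G.loopLength_pos j).le (hs.2 j) (h.conditions.loop_end j)
  have hk := h.conditions.kirchhoff
  -- By the Kirchhoff condition the left side is minus the sum of the linearization errors on the
  -- compact edges.
  have e : ∑ i, v (G.halfLine i) 0 - a * tanhSum G =
      -(∑ i, (v (G.pendant i) 0 + a * Real.tanh (G.pendantLength i)) +
        ∑ j, (v (G.loop j) 0 - v (G.loop j) (G.loopLength j) +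
          a * (2 * Real.tanh (G.loopLength j / 2)))) := by
    rw [Finset.sum_add_distrib, Finset.sum_add_distrib, ← Finset.mul_sum, ← Finset.mul_sum,
      ← Finset.mul_sum, tanhSum]
    linarith
  rw [e, abs_neg, mul_add, Finset.mul_sum, Finset.mul_sum]
  refine (abs_add_le _ _).trans (add_le_add ?_ ?_)
  · exact (Finset.abs_sum_le_sum_abs _ _).trans (Finset.sum_le_sum fun i _ => hP i)
  · exact (Finset.abs_sum_le_sum_abs _ _).trans (Finset.sum_le_sum fun j _ => hL j)

/-- The factorization `x² - 1 = (|x| - 1)(|x| + 1)`. It serves to pass from a squared slope, which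
is all the energy determines, to the slope itself. -/
theorem abs_sub_sign_le (x : ℝ) : |x - (if 0 ≤ x then 1 else -1)| ≤ |x ^ 2 - 1| := by
  have : |(|x| - 1)| ≤ |x ^ 2 - 1| := by
    rw [← sq_abs x, show |x| ^ 2 - 1 = (|x| - 1) * (|x| + 1) by ring, abs_mul]
    refine le_mul_of_one_le_right (abs_nonneg _) ?_
    rw [abs_of_nonneg (by positivity)]
    linarith [abs_nonneg x]
  refine le_trans (le_of_eq ?_) this
  split_ifs with hx
  · rw [abs_of_nonneg hx]
  · rw [abs_of_neg (not_le.1 hx), ← abs_neg]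
    congr 1; ring

/-- A small solution with small vertex value almost violates the `tanh` condition. -/
theorem IsClassical.exists_abs_tanhSum_sub_le (hp : 2 < p) {u v : G.Edge → ℝ → ℝ}
    (h : IsClassical G p u v) (hs : IsSmall G u) {a : ℝ} (ha : ∀ e, u e 0 = a) (ha0 : a ≠ 0) :
    ∃ k : ℕ, k ≤ G.H ∧ |tanhSum G - ((G.H : ℝ) - 2 * k)| ≤
      |a| ^ (p - 2) * (∑ i, G.pendantLength i + ∑ j, G.loopLength j + G.H * (2 / p)) := by
  have hp0 : 0 < p := by linarith
  have ha' : 0 < |a| := abs_pos.2 ha0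
  set ρ : Fin G.H → ℝ := fun i => v (G.halfLine i) 0 / a with hρ
  set σ : Fin G.H → ℝ := fun i => if 0 ≤ ρ i then 1 else -1 with hσ
  have hρσ : ∀ i, |ρ i - σ i| ≤ |a| ^ (p - 2) * (2 / p) := fun i => by
    refine (abs_sub_sign_le (ρ i)).trans (le_of_eq ?_)
    have hen := h.energy_halfLine hp i
    rw [ha, energy_eq hp] at hen
    -- Zero energy divided by `a²/2`: the slope-to-value ratio is close to `±1` when `a` is small.
    have e : ρ i ^ 2 - 1 = -(|a| ^ (p - 2) * (2 / p)) := by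
      simp only [hρ]
      field_simp
      field_simp at hen
      linarith
    rw [e, abs_neg, abs_of_nonneg (by positivity)]
  have hsum := h.abs_sum_halfLine_sub_le hp hs ha
  have h1 : |∑ i, ρ i - tanhSum G| ≤
      |a| ^ (p - 2) * (∑ i, G.pendantLength i + ∑ j, G.loopLength j) := by
    have e : ∑ i, v (G.halfLine i) 0 - a * tanhSum G = a * (∑ i, ρ i - tanhSum G) := by
      rw [mul_sub, Finset.mul_sum]
      congr 1
      refine Finset.sum_congr rfl fun i _ => ?_
      simp only [hρ]
      field_simp
    rw [e, abs_mul] at hsum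
    refine le_of_mul_le_mul_left (hsum.trans_eq ?_) ha'
    ring
  have h2 : |∑ i, ρ i - ∑ i, σ i| ≤ |a| ^ (p - 2) * (G.H * (2 / p)) := by
    rw [← Finset.sum_sub_distrib]
    refine (Finset.abs_sum_le_sum_abs _ _).trans ((Finset.sum_le_sum fun i _ => hρσ i).trans
      (le_of_eq ?_))
    rw [Finset.sum_const, Finset.card_univ, Fintype.card_fin, nsmul_eq_mul]
    ring
  -- `k` counts the half-lines with negative ratio; each lowers the sum of signs from `H` by two.
  refine ⟨(Finset.univ.filter fun i => ¬ 0 ≤ ρ i).card, ?_, ?_⟩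
  · exact (Finset.card_filter_le _ _).trans (by simp)
  · have e : ∑ i, σ i = (G.H : ℝ) - 2 * (Finset.univ.filter fun i => ¬ 0 ≤ ρ i).card := by
      have e1 : ∀ i, σ i = 1 - 2 * (if ¬ 0 ≤ ρ i then 1 else 0) := fun i => by
        simp only [hσ]
        split_ifs <;> norm_num
      simp only [e1]
      rw [Finset.sum_sub_distrib, ← Finset.mul_sum, Finset.sum_boole]
      simp
    rw [← e, show tanhSum G - ∑ i, σ i = -(∑ i, ρ i - tanhSum G) + (∑ i, ρ i - ∑ i, σ i) by ring,
      mul_add (|a| ^ (p - 2))]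
    refine (abs_add_le _ _).trans (add_le_add ?_ h2)
    rwa [abs_neg]

/-- Under the `tanh` condition, the Cauchy data of bound states stay away from zero. -/
theorem not_tendsto_zero (hp : 2 < p) (hG : G.TanhCondition) {U V : ℕ → G.Edge → ℝ → ℝ}
    (h : ∀ n, IsClassical G p (U n) (V n)) (hne : ∀ n, ∃ e, ∃ x ∈ G.closedEdge e, U n e x ≠ 0)
    (hU : ∀ e, Tendsto (fun n => U n e 0) atTop (𝓝 0))
    (hV : ∀ e, Tendsto (fun n => V n e 0) atTop (𝓝 0)) : False := by
  have hsmall : ∀ᶠ n in atTop, IsSmall G (U n) := by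
    have h1 : ∀ i, ∀ᶠ n in atTop, ∀ x ∈ Icc 0 (G.pendantLength i), |U n (G.pendant i) x| ≤ 1 :=
      fun i => eventually_abs_le_one hp (G.pendantLength_pos i).le
        (fun n => (h n).isSol_pendant i) (hU _) (hV _)
    have h2 : ∀ j, ∀ᶠ n in atTop, ∀ x ∈ Icc 0 (G.loopLength j), |U n (G.loop j) x| ≤ 1 :=
      fun j => eventually_abs_le_one hp (G.loopLength_pos j).le
        (fun n => (h n).isSol_loop j) (hU _) (hV _)
    exact (eventually_all.2 h1).and (eventually_all.2 h2)
  set a : ℕ → ℝ := fun n => U n (firstEdge G) 0 with ha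
  have hvert : ∀ n e, U n e 0 = a n := fun n e => (h n).conditions.vertex _ _
  set C : ℝ := ∑ i, G.pendantLength i + ∑ j, G.loopLength j + G.H * (2 / p) with hC
  set S : Set ℝ := (fun k : ℕ => (G.H : ℝ) - 2 * k) '' Iic G.H with hS
  have hev : ∀ᶠ n in atTop, ∃ z ∈ S, |tanhSum G - z| ≤ |a n| ^ (p - 2) * C :=
    hsmall.mono fun n hn => by
      have ha0 : a n ≠ 0 := fun h0 => by
        obtain ⟨e, x, hx, hux⟩ := hne n
        exact hux ((h n).eq_zero_of_isSmall hp hn (fun e => (hvert n e).trans h0) e x hx)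
      obtain ⟨k, hk, hle⟩ := (h n).exists_abs_tanhSum_sub_le hp hn (hvert n) ha0
      exact ⟨_, ⟨k, hk, rfl⟩, hle⟩
  have hlim : Tendsto (fun n => |a n| ^ (p - 2) * C) atTop (𝓝 0) := by
    have h1 := ((hU (firstEdge G)).abs.rpow_const (p := p - 2) (Or.inr (by linarith))).mul_const C
    simpa [Real.zero_rpow (show p - 2 ≠ 0 by linarith)] using h1
  -- The index `k` may vary with `n`, but `S` is finite, hence closed, and `tanhSum G` is at
  -- distance zero from it.
  have hmem : tanhSum G ∈ S := by
    have hSc : IsClosed S := ((finite_Iic G.H).image _).isClosed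
    rw [← hSc.closure_eq, Metric.mem_closure_iff]
    intro ε hε
    obtain ⟨n, ⟨z, hz, hle⟩, hlt⟩ := (hev.and (hlim.eventually (gt_mem_nhds hε))).exists
    exact ⟨z, hz, (Real.dist_eq _ _).trans_lt (hle.trans_lt hlt)⟩
  obtain ⟨k, -, hk⟩ := hmem
  simp only at hk
  -- Nonnegativity of `tanhSum G` excludes the larger values of `k`, which `TanhCondition` does not
  -- mention.
  have hk2 : k ≤ G.H / 2 := by
    have h0 := tanhSum_nonneg G
    rw [← hk] at h0
    rw [Nat.le_div_iff_mul_le two_pos]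
    have : (2 * k : ℝ) ≤ G.H := by linarith
    have : 2 * k ≤ G.H := by exact_mod_cast this
    omega
  exact hG k hk2 hk.symm

/-! ### Compactness and ground states -/

theorem IsEdge.uniqueDiffOn {s t : Set ℝ} (h : IsEdge s t) : UniqueDiffOn ℝ t := by
  rcases h with ⟨T, hT, rfl, rfl⟩ | ⟨rfl, rfl⟩
  exacts [uniqueDiffOn_Icc hT, uniqueDiffOn_Ici 0]

theorem IsEdge.Icc_subset {s t : Set ℝ} (h : IsEdge s t) {x : ℝ} (hx : x ∈ t) : Icc 0 x ⊆ t :=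
  h.ordConnected_closed.out h.zero_mem hx

/-- A solution vanishing on an edge has zero Cauchy data. -/
theorem IsH1Sol.deriv_eq_zero {s t : Set ℝ} {u v : ℝ → ℝ} (h : IsH1Sol p s t u v)
    (hu : ∀ x ∈ t, u x = 0) : v 0 = 0 := by
  have h0 := h.isEdge.zero_mem
  exact (h.isEdge.uniqueDiffOn 0 h0).eq_deriv _ (h.isSol 0 h0).1
    ((hasDerivWithinAt_const (0:ℝ) t (0:ℝ)).congr hu (hu 0 h0))

theorem integrableOn_rpow_inter_Iio (hp : 2 < p) {s t : Set ℝ} {u v : ℝ → ℝ}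
    (h : IsH1Sol p s t u v) (T : ℝ) : IntegrableOn (fun x => |u x| ^ p) (s ∩ Iio T) :=
  (h.integrable_rpow hp).mono_set inter_subset_left

/-- Convergence of the `Lᵖ` norms on bounded parts of an edge. -/
theorem tendsto_integral_inter_Iio (hp : 2 < p) {s t : Set ℝ} {u v : ℝ → ℝ}
    (h : IsH1Sol p s t u v) {U V : ℕ → ℝ → ℝ} (hUV : ∀ n, IsH1Sol p s t (U n) (V n)) {R : ℝ}
    (hR : ∀ n, ∀ x ∈ t, |U n x| ≤ R) (hlim : ∀ x ∈ t, Tendsto (fun n => U n x) atTop (𝓝 (u x)))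
    (T : ℝ) : Tendsto (fun n => ∫ x in s ∩ Iio T, |U n x| ^ p) atTop
      (𝓝 (∫ x in s ∩ Iio T, |u x| ^ p)) := by
  have hms : MeasurableSet (s ∩ Iio T) := h.isEdge.isOpen.measurableSet.inter measurableSet_Iio
  have hmem : ∀ᵐ x ∂volume.restrict (s ∩ Iio T), x ∈ t :=
    (ae_restrict_mem hms).mono fun x hx => h.isEdge.subset hx.1
  have hfin : volume (s ∩ Iio T) < ⊤ := by
    refine (measure_mono (t := Icc 0 T) fun x hx => ⟨?_, hx.2.le⟩).trans_lt measure_Icc_lt_top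
    exact h.isEdge.nonneg (h.isEdge.subset hx.1)
  refine tendsto_integral_of_dominated_convergence (fun _ => R ^ p)
    (fun n => (integrableOn_rpow_inter_Iio hp (hUV n) T).1)
    (integrableOn_const hfin.ne) (fun n => hmem.mono fun x hx => ?_) (hmem.mono fun x hx => ?_)
  · rw [Real.norm_eq_abs, abs_of_nonneg (by positivity)]
    exact Real.rpow_le_rpow (abs_nonneg _) (hR n x hx) (by linarith)
  · exact (hlim x hx).abs.rpow_const (Or.inr (by linarith))

/-- Lower semicontinuity of the `Lᵖ` norm. -/
theorem lpPow_le_of_tendsto (hp : 2 < p) {u v : G.Edge → ℝ → ℝ}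
    (h : ∀ e, IsH1Sol p (G.openEdge e) (G.closedEdge e) (u e) (v e))
    {U V : ℕ → G.Edge → ℝ → ℝ}
    (hUV : ∀ n e, IsH1Sol p (G.openEdge e) (G.closedEdge e) (U n e) (V n e)) {R : G.Edge → ℝ}
    (hR : ∀ n e, ∀ x ∈ G.closedEdge e, |U n e x| ≤ R e)
    (hlim : ∀ e, ∀ x ∈ G.closedEdge e, Tendsto (fun n => U n e x) atTop (𝓝 (u e x))) {m : ℝ}
    (hm : Tendsto (fun n => lpPow G p (U n)) atTop (𝓝 m)) : lpPow G p u ≤ m := by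
  -- Truncating at `T` before letting `n → ∞` avoids any uniform decay on the half-lines; `T → ∞` is
  -- then monotone convergence.
  have h1 : ∀ T : ℝ, ∑ e, ∫ x in G.openEdge e ∩ Iio T, |u e x| ^ p ≤ m := fun T => by
    refine le_of_tendsto_of_tendsto' (tendsto_finsetSum Finset.univ fun e _ =>
      tendsto_integral_inter_Iio hp (h e) (fun n => hUV n e) (fun n => hR n e) (hlim e) T) hm
      fun n => Finset.sum_le_sum fun e _ => ?_
    exact setIntegral_mono_set ((hUV n e).integrable_rpow hp)
      (Eventually.of_forall fun x => by positivity) inter_subset_left.eventuallyLE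
  have h2 : Tendsto (fun T : ℝ => ∑ e, ∫ x in G.openEdge e ∩ Iio T, |u e x| ^ p) atTop
      (𝓝 (lpPow G p u)) := by
    refine tendsto_finsetSum Finset.univ fun e _ => ?_
    have hU : ⋃ T : ℝ, G.openEdge e ∩ Iio T = G.openEdge e := by
      rw [← inter_iUnion, iUnion_Iio, inter_univ]
    have := tendsto_setIntegral_of_monotone (μ := volume) (f := fun x => |u e x| ^ p)
      (s := fun T : ℝ => G.openEdge e ∩ Iio T)
      (fun T => (isEdge G e).isOpen.measurableSet.inter measurableSet_Iio)
      (fun T T' hT => inter_subset_inter_right _ (Iio_subset_Iio hT))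
      (by rw [hU]; exact (h e).integrable_rpow hp)
    rwa [hU] at this
  exact le_of_tendsto' h2 h1

/-- On each edge the energy of bound states is controlled by the `Lᵖ` norm. -/
theorem exists_energy_le (hp : 2 < p) (e : G.Edge) (N : ℝ) :
    ∃ E : ℝ, ∀ u v : G.Edge → ℝ → ℝ, G.IsBoundState p u → IsClassical G p u v →
      (∀ e, G.weakDeriv u e =ᵐ[volume.restrict (G.openEdge e)] v e) → lpPow G p u ≤ N →
      energy p (u e 0) (v e 0) ≤ E := by
  rcases e with i | i | j
  · exact ⟨0, fun u v _ hv _ _ => (hv.energy_halfLine hp i).le⟩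
  · have hT := G.pendantLength_pos i
    refine ⟨N / G.pendantLength i, fun u v h hv hae hle => ?_⟩
    rw [le_div_iff₀' hT]
    exact (h.mul_energy_le hp hv hae hT rfl rfl).trans hle
  · have hT := G.loopLength_pos j
    refine ⟨N / G.loopLength j, fun u v h hv hae hle => ?_⟩
    rw [le_div_iff₀' hT]
    exact (h.mul_energy_le hp hv hae hT rfl rfl).trans hle

/-- Solutions on an edge with prescribed Cauchy data, of zero energy on half-lines. -/
theorem exists_isH1Sol (hp : 2 < p) (e : G.Edge) {a b : ℝ}
    (h : ∀ i, e = G.halfLine i → energy p a b = 0) :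
    ∃ u v : ℝ → ℝ, u 0 = a ∧ v 0 = b ∧ IsH1Sol p (G.openEdge e) (G.closedEdge e) u v := by
  rcases e with i | i | j
  · obtain ⟨u, v, hu, hv, hs, h2, h2'⟩ := exists_halfLine_isSol hp (h i rfl)
    exact ⟨u, v, hu, hv, isEdge G (G.halfLine i), hs, h2, h2'⟩
  · obtain ⟨u, v, hu, hv, hs⟩ := exists_isSol hp (G.pendantLength_pos i).le a b
    exact ⟨u, v, hu, hv, hs.isH1Sol (G.pendantLength_pos i)⟩
  · obtain ⟨u, v, hu, hv, hs⟩ := exists_isSol hp (G.loopLength_pos j).le a b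
    exact ⟨u, v, hu, hv, hs.isH1Sol (G.loopLength_pos j)⟩

/-- All conditions are linear relations between finitely many point values, hence closed under
pointwise limits. -/
theorem VertexConditions.of_tendsto {u v : G.Edge → ℝ → ℝ} {U V : ℕ → G.Edge → ℝ → ℝ}
    (h : ∀ n, VertexConditions G (U n) (V n))
    (hU : ∀ e, ∀ x ∈ G.closedEdge e, Tendsto (fun n => U n e x) atTop (𝓝 (u e x)))
    (hV : ∀ e, ∀ x ∈ G.closedEdge e, Tendsto (fun n => V n e x) atTop (𝓝 (v e x))) :
    VertexConditions G u v := by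
  have h0 : ∀ e, (0:ℝ) ∈ G.closedEdge e := fun e => (isEdge G e).zero_mem
  have hp : ∀ i, G.pendantLength i ∈ G.closedEdge (G.pendant i) := fun i =>
    right_mem_Icc.2 (G.pendantLength_pos i).le
  have hl : ∀ j, G.loopLength j ∈ G.closedEdge (G.loop j) := fun j =>
    right_mem_Icc.2 (G.loopLength_pos j).le
  refine ⟨fun e e' => ?_, fun j => ?_, fun i => ?_, ?_⟩
  · exact tendsto_nhds_unique (hU e 0 (h0 e))
      ((hU e' 0 (h0 e')).congr fun n => (h n).vertex e' e)
  · exact tendsto_nhds_unique (hU _ _ (hl j))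
      ((hU _ 0 (h0 _)).congr fun n => ((h n).loop_end j).symm)
  · exact tendsto_nhds_unique (hV _ _ (hp i))
      (tendsto_const_nhds.congr fun n => ((h n).neumann i).symm)
  · refine tendsto_nhds_unique ((tendsto_finsetSum Finset.univ fun i _ =>
      hV (G.halfLine i) 0 (h0 _)).add ((tendsto_finsetSum Finset.univ fun i _ =>
      hV (G.pendant i) 0 (h0 _)).add (tendsto_finsetSum Finset.univ fun j _ =>
      (hV (G.loop j) 0 (h0 _)).sub (hV (G.loop j) _ (hl j)))))
      (tendsto_const_nhds.congr fun n => (h n).kirchhoff.symm)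

/-- Compactness of sequences of bound states with convergent `Lᵖ` norms. -/
theorem exists_isBoundState_lpPow_le (hp : 2 < p) (hG : G.TanhCondition)
    {U : ℕ → G.Edge → ℝ → ℝ} (hU : ∀ n, G.IsBoundState p (U n)) {m : ℝ}
    (hm : Tendsto (fun n => lpPow G p (U n)) atTop (𝓝 m)) :
    ∃ u, G.IsBoundState p u ∧ lpPow G p u ≤ m := by
  choose V hV hae using fun n => (hU n).exists_isClassical hp
  obtain ⟨N, hN⟩ := hm.bddAbove_range
  have hN' : ∀ n, lpPow G p (U n) ≤ N := fun n => hN ⟨n, rfl⟩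
  choose E hE using fun e => exists_energy_le (G := G) hp e N
  choose R hR0 hR using fun e => exists_bound_of_energy_le hp (E e)
  have hEn : ∀ n e, energy p (U n e 0) (V n e 0) ≤ E e := fun n e =>
    hE e _ _ (hU n) (hV n) (hae n) (hN' n)
  have hUR : ∀ n e, ∀ x ∈ G.closedEdge e, |U n e x| ≤ R e := fun n e x hx =>
    (((hV n).isH1Sol e).isSol.abs_le_of_energy_le hp (hR e) (isEdge G e).convex_closed
      (isEdge G e).zero_mem (hEn n e) hx).1
  have hcomp : IsCompact (univ.pi fun e : G.Edge => Icc (-R e) (R e) ×ˢ Icc (-R e) (R e)) :=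
    isCompact_univ_pi fun e => isCompact_Icc.prod isCompact_Icc
  obtain ⟨d, -, φ, hφ, hd⟩ := hcomp.tendsto_subseq
    (x := fun n e => (U n e 0, V n e 0)) fun n e _ =>
      ⟨abs_le.1 (hR e _ _ (hEn n e)).1, abs_le.1 (hR e _ _ (hEn n e)).2⟩
  rw [tendsto_pi_nhds] at hd
  have hd1 : ∀ e, Tendsto (fun n => U (φ n) e 0) atTop (𝓝 (d e).1) := fun e =>
    (continuous_fst.tendsto _).comp (hd e)
  have hd2 : ∀ e, Tendsto (fun n => V (φ n) e 0) atTop (𝓝 (d e).2) := fun e =>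
    (continuous_snd.tendsto _).comp (hd e)
  -- Zero energy passes to the limit, so the limiting data on a half-line still launch an `H¹`
  -- solution.
  have hen0 : ∀ e i, e = G.halfLine i → energy p (d e).1 (d e).2 = 0 := by
    rintro _ i rfl
    refine tendsto_nhds_unique (((continuous_energy hp).tendsto _).comp (hd (G.halfLine i)))
      (tendsto_const_nhds.congr fun n => ((hV (φ n)).energy_halfLine hp i).symm)
  choose u v hu0 hv0 huv using fun e => exists_isH1Sol (G := G) hp e (hen0 e)
  have hconv : ∀ e, ∀ x ∈ G.closedEdge e, Tendsto (fun n => U (φ n) e x) atTop (𝓝 (u e x)) ∧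
      Tendsto (fun n => V (φ n) e x) atTop (𝓝 (v e x)) := fun e x hx =>
    tendsto_of_tendsto_init hp ((huv e).isSol.mono ((isEdge G e).Icc_subset hx))
      (fun n => ((hV (φ n)).isH1Sol e).isSol.mono ((isEdge G e).Icc_subset hx))
      (by rw [hu0]; exact hd1 e) (by rw [hv0]; exact hd2 e)
      ⟨(isEdge G e).nonneg hx, le_rfl⟩
  have hcl : IsClassical G p u v := ⟨huv, VertexConditions.of_tendsto
    (fun n => (hV (φ n)).conditions) (fun e x hx => (hconv e x hx).1)
    fun e x hx => (hconv e x hx).2⟩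
  have hle : lpPow G p u ≤ m := lpPow_le_of_tendsto hp huv (fun n => (hV (φ n)).isH1Sol)
    (fun n => hUR (φ n)) (fun e x hx => (hconv e x hx).1) (hm.comp hφ.tendsto_atTop)
  refine ⟨u, hcl.isBoundState hp ?_, hle⟩
  -- A zero limit would have zero Cauchy data on every edge, so the data of the sequence would tend
  -- to zero.
  by_contra! hcon
  have hz1 : ∀ e, (d e).1 = 0 := fun e => by
    rw [← hu0]; exact hcon e 0 (isEdge G e).zero_mem
  have hz2 : ∀ e, (d e).2 = 0 := fun e => by
    rw [← hv0]; exact (huv e).deriv_eq_zero (hcon e)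
  exact not_tendsto_zero hp hG (fun n => hV (φ n)) (fun n => (hU (φ n)).nontrivial)
    (fun e => hz1 e ▸ hd1 e) (fun e => hz2 e ▸ hd2 e)

/-- The compactness result applied to a minimizing sequence for `lpPow` gives a bound-state
attaining the infimum; the action is a nonnegative multiple of it. -/
theorem exists_isActionGroundState (hp : 2 < p) (hG : G.TanhCondition)
    (hex : ∃ u : G.Edge → ℝ → ℝ, G.IsBoundState p u) :
    ∃ u : G.Edge → ℝ → ℝ, G.IsActionGroundState p u := by
  set A : Set ℝ := {s | ∃ u, G.IsBoundState p u ∧ lpPow G p u = s} with hA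
  have hAne : A.Nonempty := by
    obtain ⟨u, hu⟩ := hex
    exact ⟨_, u, hu, rfl⟩
  have hAb : BddBelow A := ⟨0, by rintro _ ⟨u, -, rfl⟩; exact lpPow_nonneg u⟩
  obtain ⟨s, -, hs, hsA⟩ := exists_seq_tendsto_sInf hAne hAb
  choose U hU hUs using hsA
  obtain ⟨u, hu, hle⟩ := exists_isBoundState_lpPow_le hp hG hU (m := sInf A)
    (by simpa only [hUs] using hs)
  refine ⟨u, hu, le_antisymm (le_sInf ?_) (sInf_le ⟨u, hu, rfl⟩)⟩
  rintro _ ⟨w, hw, rfl⟩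
  rw [EReal.coe_le_coe_iff, hu.action_eq hp, hw.action_eq hp]
  have hc : 0 ≤ 1 / 2 - 1 / p := by
    rw [sub_nonneg]
    exact one_div_le_one_div_of_le two_pos hp.le
  exact mul_le_mul_of_nonneg_left (hle.trans (csInf_le hAb ⟨w, hw, rfl⟩)) hc

end NLS

theorem mainTheorem11 (G : SingleKnotGraph) (p : ℝ) (hp : 2 < p)
    (hG : Even G.H ∨
      (∃ i j : Fin G.P, i ≠ j ∧ G.pendantLength i = G.pendantLength j) ∨
      (∃ i j : Fin G.L, i ≠ j ∧ G.loopLength i = G.loopLength j)) :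
    (∃ u : G.Edge → ℝ → ℝ, G.IsBoundState p u) ∧
      (G.TanhCondition → ∃ u : G.Edge → ℝ → ℝ, G.IsActionGroundState p u) :=
  ⟨NLS.exists_isBoundState hp hG, fun hT =>
    NLS.exists_isActionGroundState hp hT (NLS.exists_isBoundState hp hG)⟩
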